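/- Let $M$ be a smooth $n$-dimensional manifold with a smooth pseudo-Riemannian metric $g$ of arbitrary signature, with Levi-Civita connection $\nabla$. Suppose that $(M,g)$ has constant curvature $\lambda\neq 0$, that is, $$R_{abcd}=\lambda\,(g_{ac}g_{bd}-g_{ad}g_{bc}),$$ where $(\nabla_a\nabla_b-\nabla_b\nabla_a)\omega_c=R_{abc}{}^{d}\omega_d$; this is the curvature form of a maximally symmetric space that is not flat. Square brackets denote antisymmetrization with weight one (a projection). Let $p\ge 1$. A smooth totally skew-symmetric tensor field $Y_{b_1\cdots b_p}$ is a *conformal Killing–Yano (CKY) tensor* of order $p$ if there is a smooth skew-symmetric tensor field $h_{b_2\cdots b_p}$ of rank $p-1$ with $$\nabla_aY_{b_1b_2\cdots b_p}+\nabla_{b_1}Y_{ab_2\cdots b_p}=2g_{a[b_1}h_{b_2\cdots b_p]}+2g_{b_1[a}h_{b_2\cdots b_p]}.\qquad(*)$$ It is a *Killing–Yano (KY) tensor* if $(*)$ holds with $h=0$, and a *closed CKY tensor* if it is a CKY tensor with $\nabla_{[a}Y_{b_1\cdots b_p]}=0$. **Theorem.** Assume $(n,p)\neq(2,1)$, and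 let $Y$ be a CKY tensor of order $p$ on $M$. 1. There are a KY tensor $A$ and a closed CKY tensor $H$, both of order $p$, such that $Y=A+H$. 2. If moreover $p<n$, then every $h$ for which $(*)$ holds is the divergence term of $Y$, $$h_{b_2\cdots b_p}=\frac{p}{2(n+1-p)}\nabla^aY_{ab_2\cdots b_p},$$ and the decomposition $Y=A+H$ into a KY tensor $A$ and a closed CKY tensor $H$ can be chosen with $$H_{b_1b_2\cdots b_p}=-\frac{2}{\lambda p}\nabla_{b_1}h_{b_2\cdots b_p}.$$ -/

import Mathlib

open scoped Manifold ContDiff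

noncomputable section

/-- The coordinate space `ℝⁿ`. -/
abbrev Coord (n : ℕ) : Type := EuclideanSpace ℝ (Fin n)

/-- The derivative at the coordinate point `e` of the inverse of the preferred chart around `x₀`:
the coordinate frame at the point of `M` with coordinates `e`. -/
def chartFrame {n : ℕ} {M : Type*} [TopologicalSpace M] [ChartedSpace (Coord n) M]
    (x₀ : M) (e : Coord n) :
    Coord n →L[ℝ] TangentSpace (𝓡 n) ((extChartAt (𝓡 n) x₀).symm e) :=
  mfderiv 𝓘(ℝ, Coord n) (𝓡 n) (extChartAt (𝓡 n) x₀).symm e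

/-- Totally skew-symmetric covariant tensor fields of rank `p` (not necessarily smooth). -/
abbrev FormField (n p : ℕ) (M : Type*) [TopologicalSpace M] [ChartedSpace (Coord n) M] : Type _ :=
  (x : M) → TangentSpace (𝓡 n) x [⋀^Fin p]→L[ℝ] ℝ

/-- The components of a skew-symmetric tensor field in the chart around `x₀`. -/
def FormField.inChart {n p : ℕ} {M : Type*} [TopologicalSpace M] [ChartedSpace (Coord n) M]
    (Y : FormField n p M) (x₀ : M) (e : Coord n) : Coord n [⋀^Fin p]→L[ℝ] ℝ :=
  (Y ((extChartAt (𝓡 n) x₀).symm e)).compContinuousLinearMap (chartFrame x₀ e)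

/-- A skew-symmetric tensor field is smooth if its components are smooth in the charts. -/
def FormField.IsSmooth {n p : ℕ} {M : Type*} [TopologicalSpace M] [ChartedSpace (Coord n) M]
    (Y : FormField n p M) : Prop :=
  ∀ x₀ : M, ContDiffOn ℝ ∞ (Y.inChart x₀) (extChartAt (𝓡 n) x₀).target

/-- The components, in the chart around `x₀`, of a field of bilinear forms. -/
def bilinInChart {n : ℕ} {M : Type*} [TopologicalSpace M] [ChartedSpace (Coord n) M]
    (b : (x : M) → TangentSpace (𝓡 n) x →L[ℝ] TangentSpace (𝓡 n) x →L[ℝ] ℝ)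
    (x₀ : M) (e : Coord n) : Coord n →L[ℝ] Coord n →L[ℝ] ℝ :=
  (ContinuousLinearMap.precomp ℝ (chartFrame x₀ e)).comp
    ((b ((extChartAt (𝓡 n) x₀).symm e)).comp (chartFrame x₀ e))

/-- A smooth pseudo-Riemannian metric, of arbitrary signature. -/
structure PseudoRiemannianMetric (n : ℕ) (M : Type*) [TopologicalSpace M]
    [ChartedSpace (Coord n) M] where
  /-- the bilinear form on each tangent space -/
  val : (x : M) → TangentSpace (𝓡 n) x →L[ℝ] TangentSpace (𝓡 n) x →L[ℝ] ℝ
  symm : ∀ (x : M) (u v : TangentSpace (𝓡 n) x), val x u v = val x v u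
  nondegenerate : ∀ (x : M) (u : TangentSpace (𝓡 n) x), (∀ v, val x u v = 0) → u = 0
  smooth : ∀ x₀ : M, ContDiffOn ℝ ∞ (bilinInChart val x₀) (extChartAt (𝓡 n) x₀).target

/-- Total antisymmetrization `T_{[b₁⋯b_p]}`, normalized so as to be a projection. -/
def antisymmetrize {V : Type*} {p : ℕ} (T : (Fin p → V) → ℝ) (v : Fin p → V) : ℝ :=
  (p.factorial : ℝ)⁻¹ *
    ∑ σ : Equiv.Perm (Fin p), ((Equiv.Perm.sign σ : ℤ) : ℝ) * T (v ∘ σ)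

namespace PseudoRiemannianMetric

variable {n : ℕ} {M : Type*} [TopologicalSpace M] [ChartedSpace (Coord n) M]

/-- The components `g_{ab}` of the metric in the chart around `x₀`. -/
def inChart (g : PseudoRiemannianMetric n M) (x₀ : M) (e : Coord n) :
    Coord n →L[ℝ] Coord n →L[ℝ] ℝ :=
  bilinInChart g.val x₀ e

/-- Raising an index with the inverse metric `g^{ab}`. -/
def sharp (g : PseudoRiemannianMetric n M) (x₀ : M) (e : Coord n) :
    (Coord n →L[ℝ] ℝ) →L[ℝ] Coord n :=
  (g.inChart x₀ e).inverse

/-- The Christoffel symbols of the first kind, as the linear form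
`w ↦ (∂_u g(v, w) + ∂_v g(u, w) - ∂_w g(u, v)) / 2`. -/
def christoffelFirst (g : PseudoRiemannianMetric n M) (x₀ : M) (e u v : Coord n) :
    Coord n →L[ℝ] ℝ :=
  (1 / 2 : ℝ) • (fderiv ℝ (g.inChart x₀) e u v + fderiv ℝ (g.inChart x₀) e v u -
    ((fderiv ℝ (g.inChart x₀) e).flip u).flip v)

/-- The Christoffel symbols `Γ(u, v)` of the Levi-Civita connection in the chart around `x₀`. -/
def christoffel (g : PseudoRiemannianMetric n M) (x₀ : M) (e u v : Coord n) : Coord n :=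
  g.sharp x₀ e (g.christoffelFirst x₀ e u v)

/-- The curvature endomorphism `R(u, v) w = ∇_u ∇_v w - ∇_v ∇_u w - ∇_{[u, v]} w` of the
Levi-Civita connection in the chart around `x₀`. -/
def curvature (g : PseudoRiemannianMetric n M) (x₀ : M) (e u v w : Coord n) : Coord n :=
  fderiv ℝ (fun e' => g.christoffel x₀ e' v w) e u -
    fderiv ℝ (fun e' => g.christoffel x₀ e' u w) e v +
    g.christoffel x₀ e u (g.christoffel x₀ e v w) -
    g.christoffel x₀ e v (g.christoffel x₀ e u w)

/-- The Riemann tensor `R_{abcd} = g(R(a, b) d, c)`. For vector fields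
`(∇_a ∇_b - ∇_b ∇_a) X^c = R_{ab}{}^c{}_d X^d`, for one-forms
`(∇_a ∇_b - ∇_b ∇_a) Y_c = R_{abc}{}^d Y_d`. -/
def riemann (g : PseudoRiemannianMetric n M) (x₀ : M) (e a b c d : Coord n) : ℝ :=
  g.inChart x₀ e (g.curvature x₀ e a b d) c

/-- Constant curvature `lam`: `R_{abcd} = lam (g_{ac} g_{bd} - g_{ad} g_{bc})` on all of `M`. -/
def HasConstantCurvature (g : PseudoRiemannianMetric n M) (lam : ℝ) : Prop :=
  ∀ x₀ : M, ∀ e ∈ (extChartAt (𝓡 n) x₀).target, ∀ a b c d : Coord n,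
    g.riemann x₀ e a b c d =
      lam * (g.inChart x₀ e a c * g.inChart x₀ e b d - g.inChart x₀ e a d * g.inChart x₀ e b c)

/-- The Levi-Civita covariant derivative `∇_u Y (v₁, …, v_p)` of a skew-symmetric tensor field,
in the chart around `x₀`, at the coordinate point `e`. -/
def nabla (g : PseudoRiemannianMetric n M) {p : ℕ} (Y : FormField n p M) (x₀ : M)
    (e u : Coord n) (v : Fin p → Coord n) : ℝ :=
  fderiv ℝ (Y.inChart x₀) e u v -
    ∑ i, Y.inChart x₀ e (Function.update v i (g.christoffel x₀ e u (v i)))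

/-- The divergence `∇^a Y_{a b₂ ⋯ b_p} = g^{ac} ∇_c Y_{a b₂ ⋯ b_p}`, here `p = k + 1`. -/
def divergence (g : PseudoRiemannianMetric n M) {k : ℕ} (Y : FormField n (k + 1) M) (x₀ : M)
    (e : Coord n) (v : Fin k → Coord n) : ℝ :=
  ∑ c : Fin n, g.nabla Y x₀ e (EuclideanSpace.single c 1)
    (Fin.cons (g.sharp x₀ e (EuclideanSpace.proj c)) v)

/-- The tensor `g_{a[b₁} h_{b₂ ⋯ b_p]}`, here `p = k + 1` and `b` lists `b₁, …, b_p`. -/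
def metricWedge (g : PseudoRiemannianMetric n M) {k : ℕ} (h : FormField n k M) (x₀ : M)
    (e a : Coord n) (b : Fin (k + 1) → Coord n) : ℝ :=
  antisymmetrize (fun w => g.inChart x₀ e a (w 0) * h.inChart x₀ e (Fin.tail w)) b

/-- `Y`, of rank `p = k + 1`, satisfies the conformal Killing-Yano equation with the
skew-symmetric tensor `h` of rank `p - 1`:
`∇_a Y_{b₁⋯b_p} + ∇_{b₁} Y_{a b₂⋯b_p} = 2 g_{a[b₁} h_{b₂⋯b_p]} + 2 g_{b₁[a} h_{b₂⋯b_p]}`. -/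
def IsCKYWith (g : PseudoRiemannianMetric n M) {k : ℕ} (Y : FormField n (k + 1) M)
    (h : FormField n k M) : Prop :=
  Y.IsSmooth ∧ h.IsSmooth ∧
    ∀ x₀ : M, ∀ e ∈ (extChartAt (𝓡 n) x₀).target,
      ∀ (a b₁ : Coord n) (b : Fin k → Coord n),
        g.nabla Y x₀ e a (Fin.cons b₁ b) + g.nabla Y x₀ e b₁ (Fin.cons a b) =
          2 * g.metricWedge h x₀ e a (Fin.cons b₁ b) + 2 * g.metricWedge h x₀ e b₁ (Fin.cons a b)

/-- Conformal Killing-Yano tensors of order `k + 1`. -/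
def IsCKY (g : PseudoRiemannianMetric n M) {k : ℕ} (Y : FormField n (k + 1) M) : Prop :=
  ∃ h : FormField n k M, g.IsCKYWith Y h

/-- Killing-Yano tensors of order `k + 1`: conformal Killing-Yano tensors with `h = 0`. -/
def IsKY (g : PseudoRiemannianMetric n M) {k : ℕ} (Y : FormField n (k + 1) M) : Prop :=
  g.IsCKYWith Y 0

/-- Closed conformal Killing-Yano tensors of order `k + 1`: conformal Killing-Yano tensors with
`∇_{[a} Y_{b₁⋯b_p]} = 0`. -/
def IsClosedCKY (g : PseudoRiemannianMetric n M) {k : ℕ} (Y : FormField n (k + 1) M) : Prop :=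
  g.IsCKY Y ∧ ∀ x₀ : M, ∀ e ∈ (extChartAt (𝓡 n) x₀).target, ∀ v : Fin (k + 2) → Coord n,
    antisymmetrize (fun w : Fin (k + 2) → Coord n => g.nabla Y x₀ e (w 0) (Fin.tail w)) v = 0

end PseudoRiemannianMetric

end

/-! Write `p = k + 1`, `η = (2/p) h`, and `u♭ = G u`. The CKY equation says that `∇_u Y - u♭ ∧ η` is
skew in `u` and the first slot, so it is equivalent to `∇_u Y = ι_u K + u♭ ∧ η` with `K = dY/(p+1)`
(`cov_eq_of_cky`). Commuting derivatives in constant curvature turns any equation of this shape into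
an algebraic condition on the next derivatives (`integrability`), and the proof prolongs the system
in this way until it closes.

For `p < n`, the condition on `Y` involves `∇K` and `θ_u = ∇_u η + λ ι_u Y`. Its traces force `θ` to
be skew, hence `∇_u η = ι_u dη / p` (`cov_divergence_eq`) and `θ_u = ι_u Θ` with `Θ = λ Y + dη/p`.
One more integrability condition gives `∇_u Θ = λ ι_u K` (`cov_killing_part`). The right side is
skew in `u` and the first slot, so `A = Θ/λ` is Killing–Yano. The remainder `H = Y - A = -dη/(λp)`
satisfies `∇_u H = u♭ ∧ η`, which is the CKY equation with the same `h` and has zero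
antisymmetrization because `G` is symmetric.

The last step differs by degree. For `p ≥ 2` it uses the condition on `η`: a tensor symmetric in its
first two slots and skew in the others vanishes. For `p = 1` there are too few slots, and the
condition on `K` is used instead; its trace has the coefficient `n - 2`, which is why `(n,p) =
(2,1)` is excluded.

For `p ≥ n`, `dY = 0` by degree, so `A = 0`, `H = Y` works. -/

noncomputable section

/-! ### Algebra of interior product, wedge, and the derivation action of endomorphisms. -/

namespace SkewForm

open ContinuousAlternatingMap (alternatizeUncurryFin alternatizeUncurryFinCLM curryLeftLI
  fderivCompContinuousLinearMapCLM fderivCompContinuousLinearMap_apply curryLeft_apply_apply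
  alternatizeUncurryFin_apply alternatizeUncurryFinCLM_apply curryLeft_same coe_toAlternatingMap)

variable {E : Type*} [NormedAddCommGroup E] [NormedSpace ℝ E] {m : ℕ}

/-- The interior product of a form with a vector. -/
def interior : E →L[ℝ] (E [⋀^Fin (m + 1)]→L[ℝ] ℝ) →L[ℝ] (E [⋀^Fin m]→L[ℝ] ℝ) :=
  (curryLeftLI.toContinuousLinearMap).flip

theorem interior_apply (v : E) (φ : E [⋀^Fin (m + 1)]→L[ℝ] ℝ) (w : Fin m → E) :
    interior v φ w = φ (Fin.cons v w) := rfl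

/-- The exterior product `α ∧ φ` of a form with a one-form. -/
def wedge : (E →L[ℝ] ℝ) →L[ℝ] (E [⋀^Fin m]→L[ℝ] ℝ) →L[ℝ] (E [⋀^Fin (m + 1)]→L[ℝ] ℝ) :=
  (ContinuousLinearMap.compL ℝ _ _ _ (alternatizeUncurryFinCLM ℝ E ℝ)) ∘L
    ContinuousLinearMap.smulRightL ℝ E (E [⋀^Fin m]→L[ℝ] ℝ)

theorem wedge_apply (α : E →L[ℝ] ℝ) (φ : E [⋀^Fin m]→L[ℝ] ℝ) :
    wedge α φ = alternatizeUncurryFin (α.smulRight φ) := rfl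

/-- The action of an endomorphism on forms by derivations. -/
def act : (E →L[ℝ] E) →L[ℝ] (E [⋀^Fin m]→L[ℝ] ℝ) →L[ℝ] (E [⋀^Fin m]→L[ℝ] ℝ) :=
  (fderivCompContinuousLinearMapCLM ℝ (ContinuousLinearMap.id ℝ E)).flip

theorem act_apply (T : E →L[ℝ] E) (φ : E [⋀^Fin m]→L[ℝ] ℝ) (v : Fin m → E) :
    act T φ v = ∑ i, φ (Function.update v i (T (v i))) := by
  change φ.fderivCompContinuousLinearMap (ContinuousLinearMap.id ℝ E) T v = _
  rw [fderivCompContinuousLinearMap_apply]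
  refine Finset.sum_congr rfl fun i _ => congrArg φ (funext fun j => ?_)
  rcases eq_or_ne j i with rfl | h
  · simp
  · simp [h]

@[simp] theorem act_of_degree_zero (T : E →L[ℝ] E) (φ : E [⋀^Fin 0]→L[ℝ] ℝ) : act T φ = 0 := by
  ext v; simp [act_apply]

/-- This is the induction principle for identities of forms: contract with an arbitrary vector and
lower the degree. Degree zero has no interior product, hence the separate `_zero` variants of the
contraction rules. -/
theorem ext_interior {φ φ' : E [⋀^Fin (m + 1)]→L[ℝ] ℝ}
    (h : ∀ v, interior v φ = interior v φ') : φ = φ' := by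
  ext v
  have := congrArg (fun f => f (Fin.tail v)) (h (v 0))
  simpa [interior_apply, Fin.cons_self_tail] using this

theorem interior_alternatize (f : E →L[ℝ] E [⋀^Fin (m + 1)]→L[ℝ] ℝ) (v : E) :
    interior v (alternatizeUncurryFin f) =
      f v - alternatizeUncurryFin ((interior v) ∘L f) := by
  ext w
  rw [interior_apply, alternatizeUncurryFin_apply, Fin.sum_univ_succ,
    ContinuousAlternatingMap.sub_apply, alternatizeUncurryFin_apply, sub_eq_add_neg,
    ← Finset.sum_neg_distrib]
  congr 1
  · simp
  · refine Finset.sum_congr rfl fun i _ => ?_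
    have : Fin.removeNth i.succ (Fin.cons v w : Fin (m + 2) → E) =
        (Fin.cons v (Fin.removeNth i w) : Fin (m + 1) → E) := by
      funext j
      cases j using Fin.cases <;> simp [Fin.removeNth]
    rw [this]
    simp [pow_succ, interior_apply]

theorem interior_alternatize_zero (f : E →L[ℝ] E [⋀^Fin 0]→L[ℝ] ℝ) (v : E) :
    interior v (alternatizeUncurryFin f) = f v := by
  ext w
  rw [interior_apply, alternatizeUncurryFin_apply, Fin.sum_univ_succ]
  simp only [Finset.univ_eq_empty, Finset.sum_empty, add_zero, Fin.val_zero, pow_zero, one_smul,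
    Fin.cons_zero]
  exact congrArg _ (Subsingleton.elim _ _)

theorem interior_wedge (α : E →L[ℝ] ℝ) (φ : E [⋀^Fin (m + 1)]→L[ℝ] ℝ) (v : E) :
    interior v (wedge α φ) = α v • φ - wedge α (interior v φ) := by
  rw [wedge_apply, interior_alternatize, wedge_apply]
  congr 2

theorem interior_wedge_zero (α : E →L[ℝ] ℝ) (φ : E [⋀^Fin 0]→L[ℝ] ℝ) (v : E) :
    interior v (wedge α φ) = α v • φ := by
  rw [wedge_apply, interior_alternatize_zero]; rfl

@[simp] theorem interior_interior_self (φ : E [⋀^Fin (m + 2)]→L[ℝ] ℝ) (v : E) :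
    interior v (interior v φ) = 0 := curryLeft_same φ v

theorem interior_comm (φ : E [⋀^Fin (m + 2)]→L[ℝ] ℝ) (v w : E) :
    interior w (interior v φ) = -interior v (interior w φ) := by
  have h := interior_interior_self φ (v + w)
  simp only [map_add, add_apply, interior_interior_self] at h
  rw [eq_neg_iff_add_eq_zero]
  simpa using h

theorem interior_act (T : E →L[ℝ] E) (φ : E [⋀^Fin (m + 1)]→L[ℝ] ℝ) (v : E) :
    interior v (act T φ) = interior (T v) φ + act T (interior v φ) := by
  ext w
  rw [interior_apply, act_apply, Fin.sum_univ_succ, ContinuousAlternatingMap.add_apply,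
    act_apply]
  congr 1
  · rw [interior_apply]
    congr 1
    funext j
    cases j using Fin.cases <;> simp
  · refine Finset.sum_congr rfl fun i _ => ?_
    rw [interior_apply]
    congr 1
    funext j
    cases j using Fin.cases with
    | zero => simp [Function.update_of_ne (Fin.succ_ne_zero i).symm]
    | succ j =>
      rcases eq_or_ne j i with rfl | h
      · simp
      · simp [Function.update_of_ne h, Function.update_of_ne (fun h' => h (Fin.succ_inj.1 h'))]

theorem act_wedge (T : E →L[ℝ] E) (α : E →L[ℝ] ℝ) (φ : E [⋀^Fin m]→L[ℝ] ℝ) :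
    act T (wedge α φ) = wedge (α ∘L T) φ + wedge α (act T φ) := by
  induction m with
  | zero =>
    refine ext_interior fun v => ?_
    simp [interior_act, interior_wedge_zero]
  | succ m ih =>
    refine ext_interior fun v => ?_
    simp only [interior_act, map_add, interior_wedge, map_sub, map_smul, ih,
      ContinuousLinearMap.comp_apply]
    abel

/-- The action is by precomposition, so it reverses the order of the commutator. This is the origin
of the minus sign in `cov_cov_sub`. -/
theorem act_act_sub (S T : E →L[ℝ] E) (φ : E [⋀^Fin m]→L[ℝ] ℝ) :
    act S (act T φ) - act T (act S φ) = act (T ∘L S - S ∘L T) φ := by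
  induction m with
  | zero => simp
  | succ m ih =>
    refine ext_interior fun v => ?_
    rw [interior_act, ← ih]
    simp only [interior_act, map_add, map_sub, sub_apply, ContinuousLinearMap.comp_apply]
    abel

/-- The constant curvature endomorphism is a combination of rank-one maps; this turns its action on
forms into wedges and contractions. -/
theorem act_smulRight (α : E →L[ℝ] ℝ) (x : E) (φ : E [⋀^Fin (m + 1)]→L[ℝ] ℝ) :
    act (α.smulRight x) φ = wedge α (interior x φ) := by
  induction m with
  | zero =>
    refine ext_interior fun v => ?_
    simp [interior_act, interior_wedge_zero]
  | succ m ih =>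
    refine ext_interior fun v => ?_
    rw [interior_act, interior_wedge, ih, interior_comm φ x v]
    simp [sub_eq_add_neg]

/-- The signed sum of `alternatizeUncurryFin f (v ∘ σ)` over all `σ` is computed twice: by skewness
it is `(m+1)!` equal terms, and by expansion it is `m+1` copies of the full signed sum `S`. -/
theorem antisymmetrize_eq_alternatize (f : E →L[ℝ] E [⋀^Fin m]→L[ℝ] ℝ) (v : Fin (m + 1) → E) :
    antisymmetrize (fun w : Fin (m + 1) → E => f (w 0) (Fin.tail w)) v =
      (m + 1 : ℝ)⁻¹ * alternatizeUncurryFin f v := by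
  set S : ℝ := ∑ σ : Equiv.Perm (Fin (m + 1)), ((Equiv.Perm.sign σ : ℤ) : ℝ) *
    f ((v ∘ σ) 0) (Fin.tail (v ∘ σ)) with hS
  have h1 : ∑ σ : Equiv.Perm (Fin (m + 1)), ((Equiv.Perm.sign σ : ℤ) : ℝ) *
      alternatizeUncurryFin f (v ∘ σ) = ((m + 1).factorial : ℝ) * alternatizeUncurryFin f v := by
    have : ∀ σ : Equiv.Perm (Fin (m + 1)), ((Equiv.Perm.sign σ : ℤ) : ℝ) *
        alternatizeUncurryFin f (v ∘ σ) = alternatizeUncurryFin f v := by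
      intro σ
      have := (alternatizeUncurryFin f).toAlternatingMap.map_perm v σ
      simp only [coe_toAlternatingMap] at this
      rw [this, Units.smul_def, zsmul_eq_mul, ← mul_assoc, ← Int.cast_mul]
      simp
    simp [this, Fintype.card_perm]
  have h2 : ∑ σ : Equiv.Perm (Fin (m + 1)), ((Equiv.Perm.sign σ : ℤ) : ℝ) *
      alternatizeUncurryFin f (v ∘ σ) = (m + 1 : ℝ) * S := by
    simp only [alternatizeUncurryFin_apply, Finset.mul_sum]
    rw [Finset.sum_comm]
    have : ∀ i : Fin (m + 1), ∑ σ : Equiv.Perm (Fin (m + 1)), ((Equiv.Perm.sign σ : ℤ) : ℝ) *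
        ((-1) ^ (i : ℕ) • f ((v ∘ σ) i) (i.removeNth (v ∘ σ))) = S := by
      intro i
      -- The cycle moves position `i` to the front and keeps the order of the rest; its sign
      -- `(-1)^i` matches the alternating coefficient.
      conv_rhs => rw [hS, ← Equiv.sum_comp (Equiv.mulRight (Fin.cycleRange i)⁻¹)]
      refine Finset.sum_congr rfl fun σ _ => ?_
      have e0 : (v ∘ ⇑(Equiv.mulRight (Fin.cycleRange i)⁻¹ σ)) 0 = (v ∘ σ) i := by
        simp [Equiv.Perm.inv_def]
      have e1 : Fin.tail (v ∘ ⇑(Equiv.mulRight (Fin.cycleRange i)⁻¹ σ)) =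
          i.removeNth (v ∘ σ) := by
        funext j
        simp [Fin.tail, Fin.removeNth, Equiv.Perm.inv_def]
      rw [e0, e1]
      simp [Fin.sign_cycleRange]
      ring
    rw [Finset.sum_congr rfl fun i _ => this i]
    simp
  rw [antisymmetrize]
  change _ * S = _
  have h3 := h2.symm.trans h1
  have hm : (m + 1 : ℝ) ≠ 0 := by positivity
  have hf : ((m + 1).factorial : ℝ) ≠ 0 := by positivity
  field_simp
  linarith

theorem alternatize_interior (φ : E [⋀^Fin (m + 1)]→L[ℝ] ℝ) :
    alternatizeUncurryFin (interior.flip φ) = (m + 1 : ℝ) • φ := by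
  refine (ContinuousAlternatingMap.alternatizeUncurryFin_curryLeft φ).trans ?_
  rw [← Nat.cast_smul_eq_nsmul ℝ]
  simp

/-- A form-valued linear map that is skew in its argument and the first slot of the form comes
from a form of higher degree. -/
theorem interior_alternatize_of_skew (f : E →L[ℝ] E [⋀^Fin (m + 1)]→L[ℝ] ℝ)
    (hf : ∀ u v, interior v (f u) = -interior u (f v)) (v : E) :
    interior v (alternatizeUncurryFin f) = (m + 2 : ℝ) • f v := by
  have : (interior v) ∘L f = -interior.flip (f v) := by
    ext x : 1
    simp [hf x v]
  rw [interior_alternatize, this, ← alternatizeUncurryFinCLM_apply, map_neg,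
    alternatizeUncurryFinCLM_apply, alternatize_interior]
  module

theorem eq_zero_of_eq_neg {V : Type*} [AddCommGroup V] [Module ℝ V] {x : V} (h : x = -x) :
    x = 0 := by
  have h2 : (2 : ℝ) • x = 0 := by
    rw [two_smul]
    nth_rewrite 1 [h]
    simp
  simpa using h2

/-- Alternating the symmetry in slots 1, 2 with the skewness in slots 2, 3 returns to the initial
arrangement with three sign changes. The form needs degree at least two. -/
theorem eq_zero_of_interior_symm (κ : E → E [⋀^Fin (m + 2)]→L[ℝ] ℝ)
    (hκ : ∀ u v, interior v (κ u) = interior u (κ v)) (u : E) : κ u = 0 := by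
  refine ext_interior fun v => ext_interior fun w => ?_
  have h : ∀ u v w, interior w (interior v (κ u)) = -interior v (interior w (κ u)) :=
    fun u v w => interior_comm (κ u) v w
  have h1 : interior w (interior v (κ u)) = -interior w (interior v (κ u)) := by
    conv_lhs => rw [hκ u v, h v u w, hκ v w, h w v u, hκ w u, h u w v]
    simp
  have := eq_zero_of_eq_neg h1
  simpa using this

theorem alternatize_wedge_of_symm (G : E →L[ℝ] E →L[ℝ] ℝ) (hG : ∀ u v, G u v = G v u)
    (φ : E [⋀^Fin m]→L[ℝ] ℝ) : alternatizeUncurryFin (wedge.flip φ ∘L G) = 0 := by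
  have := ContinuousAlternatingMap.alternatizeUncurryFin_alternatizeUncurryFinCLM_comp_of_symmetric
    (f := ((ContinuousLinearMap.smulRightL ℝ E (E [⋀^Fin m]→L[ℝ] ℝ)).flip φ) ∘L G)
    (fun x y => by simp [hG x y])
  exact this

theorem alternatize_act_of_symm (Γ : E →L[ℝ] E →L[ℝ] E) (hΓ : ∀ u v, Γ u v = Γ v u)
    (φ : E [⋀^Fin m]→L[ℝ] ℝ) : alternatizeUncurryFin (act.flip φ ∘L Γ) = 0 :=
  ContinuousAlternatingMap.alternatizeUncurryFin_fderivCompContinuousLinearMap_eq_zero φ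
    (ContinuousLinearMap.id ℝ E) hΓ

end SkewForm
end

/-! ### Traces against dual frames and the algebraic consequences of integrability. -/

noncomputable section

namespace SkewForm

open ContinuousAlternatingMap (alternatizeUncurryFin)

variable {E : Type*} [NormedAddCommGroup E] [NormedSpace ℝ E] {m n : ℕ}

/-- The frames `b` and `c` are dual to each other with respect to the bilinear form `G`. -/
structure IsDualFrame (G : E →L[ℝ] E →L[ℝ] ℝ) (b c : Fin n → E) : Prop where
  symm : ∀ u v, G u v = G v u
  trace : ∑ i, G (b i) (c i) = n
  sum_left : ∀ x, ∑ i, G (b i) x • c i = x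
  sum_right : ∀ x, ∑ i, G x (c i) • b i = x

namespace IsDualFrame

variable {G : E →L[ℝ] E →L[ℝ] ℝ} {b c : Fin n → E}

/-- The sum contracts a skew form with the inverse metric, which is symmetric. -/
theorem sum_interior_interior (h : IsDualFrame G b c) (φ : E [⋀^Fin (m + 2)]→L[ℝ] ℝ) :
    ∑ i, interior (c i) (interior (b i) φ) = 0 := by
  have h1 : ∑ i, interior (c i) (interior (b i) φ) =
      ∑ i, ∑ j, G (b j) (b i) • interior (c i) (interior (c j) φ) := by
    refine Finset.sum_congr rfl fun i _ => ?_
    conv_lhs => rw [← h.sum_left (b i)]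
    simp [map_sum]
  have h2 : ∑ i, ∑ j, G (b j) (b i) • interior (c i) (interior (c j) φ) =
      -∑ i, ∑ j, G (b j) (b i) • interior (c i) (interior (c j) φ) := by
    conv_rhs => rw [Finset.sum_comm]
    rw [← Finset.sum_neg_distrib]
    refine Finset.sum_congr rfl fun i _ => ?_
    rw [← Finset.sum_neg_distrib]
    refine Finset.sum_congr rfl fun j _ => ?_
    rw [interior_comm φ (c j) (c i), h.symm, smul_neg]
  rw [h1]
  exact eq_zero_of_eq_neg h2

theorem sum_wedge_interior (h : IsDualFrame G b c) (φ : E [⋀^Fin (m + 1)]→L[ℝ] ℝ) :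
    ∑ i, wedge (G (b i)) (interior (c i) φ) = (m + 1 : ℝ) • φ := by
  rw [← alternatize_interior]
  simp only [wedge_apply, ← ContinuousAlternatingMap.alternatizeUncurryFinCLM_apply]
  rw [← map_sum]
  congr 1
  ext x : 1
  conv_rhs => rw [← h.sum_left x]
  simp [map_sum]

theorem sum_interior_wedge (h : IsDualFrame G b c) (φ : E [⋀^Fin m]→L[ℝ] ℝ) :
    ∑ i, interior (c i) (wedge (G (b i)) φ) = ((n : ℝ) - m) • φ := by
  cases m with
  | zero => simp [interior_wedge_zero, ← Finset.sum_smul, h.trace]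
  | succ m =>
    simp only [interior_wedge, Finset.sum_sub_distrib, ← Finset.sum_smul, h.trace,
      h.sum_wedge_interior]
    push_cast
    module

/-- Tracing over `v` expresses `θ u` through the traces `D` of `κ` and `t` of `θ`. Tracing again
kills `t`, and then `θ u` is a multiple of `interior u D`, which is skew. -/
theorem skew_of_integrability (h : IsDualFrame G b c) (hn : m + 2 < n)
    (κ : E →L[ℝ] E [⋀^Fin (m + 3)]→L[ℝ] ℝ) (θ : E →L[ℝ] E [⋀^Fin (m + 1)]→L[ℝ] ℝ)
    (hE : ∀ u v, interior v (κ u) - interior u (κ v) + wedge (G v) (θ u) - wedge (G u) (θ v) = 0)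
    (u v : E) : interior v (θ u) = -interior u (θ v) := by
  set D := ∑ i, interior (c i) (κ (b i)) with hD
  set t := ∑ i, interior (c i) (θ (b i)) with ht
  have hn' : (m + 2 : ℝ) < n := by exact_mod_cast hn
  have key : ∀ u, ((n : ℝ) - (m + 2)) • θ u = -interior u D - wedge (G u) t := by
    intro u
    have h1 : ∑ i, interior (c i) (interior (b i) (κ u) - interior u (κ (b i)) +
        wedge (G (b i)) (θ u) - wedge (G u) (θ (b i))) = 0 := by
      simp [hE]
    simp only [map_add, map_sub, Finset.sum_add_distrib, Finset.sum_sub_distrib,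
      h.sum_interior_interior, h.sum_interior_wedge] at h1
    simp only [interior_wedge, Finset.sum_sub_distrib] at h1
    have h2 : ∑ i, interior (c i) (interior u (κ (b i))) = -interior u D := by
      rw [hD, map_sum, ← Finset.sum_neg_distrib]
      exact Finset.sum_congr rfl fun i _ => interior_comm _ _ _
    have h3 : ∑ i, G u (c i) • θ (b i) = θ u := by
      conv_rhs => rw [← h.sum_right u]
      simp [map_sum]
    have h4 : ∑ i, wedge (G u) (interior (c i) (θ (b i))) = wedge (G u) t := by
      rw [ht, map_sum]
    rw [h2, h3, h4] at h1
    push_cast at h1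
    linear_combination (norm := module) h1
  have ht0 : t = 0 := by
    have h1 : ∑ i, interior (c i) (((n : ℝ) - (m + 2)) • θ (b i)) =
        ∑ i, interior (c i) (-interior (b i) D - wedge (G (b i)) t) :=
      Finset.sum_congr rfl fun i _ => by rw [key]
    simp only [map_smul, map_sub, map_neg, Finset.sum_sub_distrib, Finset.sum_neg_distrib,
      h.sum_interior_interior, h.sum_interior_wedge, ← Finset.smul_sum, ← ht] at h1
    -- The factor equals `2 (n - m - 1)`, positive since `m + 2 < n`.
    have h2 : ((n : ℝ) - (m + 2) + (n - m)) • t = 0 := by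
      rw [add_smul, h1]; simp
    exact (smul_eq_zero.1 h2).resolve_left (by linarith)
  have hne : ((n : ℝ) - (m + 2)) ≠ 0 := by linarith
  have h1 : ((n : ℝ) - (m + 2)) • (interior v (θ u) + interior u (θ v)) = 0 := by
    rw [smul_add, ← map_smul (interior v), ← map_smul (interior u), key, key, ht0]
    simp [interior_comm D u v]
  exact eq_neg_of_add_eq_zero_left ((smul_eq_zero.1 h1).resolve_left hne)

theorem eq_zero_of_wedge_symm (h : IsDualFrame G b c) (hn : m + 2 < n)
    (ψ : E →L[ℝ] E [⋀^Fin (m + 1)]→L[ℝ] ℝ)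
    (hψ : ∀ u v, wedge (G u) (ψ v) = wedge (G v) (ψ u)) : ψ = 0 := by
  set t := ∑ i, interior (c i) (ψ (b i)) with ht
  have hn' : (m + 2 : ℝ) < n := by exact_mod_cast hn
  have key : ∀ v, ((n : ℝ) - (m + 2)) • ψ v = -wedge (G v) t := by
    intro v
    have h1 : ∑ i, interior (c i) (wedge (G (b i)) (ψ v)) =
        ∑ i, interior (c i) (wedge (G v) (ψ (b i))) :=
      Finset.sum_congr rfl fun i _ => by rw [hψ]
    have h3 : ∑ i, G v (c i) • ψ (b i) = ψ v := by
      conv_rhs => rw [← h.sum_right v]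
      simp [map_sum]
    rw [h.sum_interior_wedge] at h1
    simp only [interior_wedge, Finset.sum_sub_distrib, h3, ← map_sum, ← ht] at h1
    push_cast at h1
    linear_combination (norm := module) h1
  have ht0 : t = 0 := by
    have h1 : ∑ i, interior (c i) (((n : ℝ) - (m + 2)) • ψ (b i)) =
        ∑ i, interior (c i) (-wedge (G (b i)) t) :=
      Finset.sum_congr rfl fun i _ => by rw [key]
    simp only [map_smul, map_neg, Finset.sum_neg_distrib, h.sum_interior_wedge,
      ← Finset.smul_sum, ← ht] at h1
    have h2 : ((n : ℝ) - (m + 2) + (n - m)) • t = 0 := by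
      rw [add_smul, h1]; simp
    exact (smul_eq_zero.1 h2).resolve_left (by linarith)
  have hne : ((n : ℝ) - (m + 2)) ≠ 0 := by linarith
  ext v : 1
  have h1 := key v
  rw [ht0] at h1
  simpa [hne] using h1

end IsDualFrame

/-- Up to the symmetric term `G u v • θ`, the condition says that `κ u + wedge (G u) θ` has the
symmetry required by `eq_zero_of_interior_symm`. -/
theorem eq_neg_wedge_of_integrability (G : E →L[ℝ] E →L[ℝ] ℝ) (hG : ∀ u v, G u v = G v u)
    (κ : E → E [⋀^Fin (m + 2)]→L[ℝ] ℝ) (θ : E [⋀^Fin (m + 1)]→L[ℝ] ℝ)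
    (hE : ∀ u v, interior v (κ u) - interior u (κ v) + wedge (G v) (interior u θ) -
      wedge (G u) (interior v θ) = 0) (u : E) : κ u = -wedge (G u) θ := by
  have := eq_zero_of_interior_symm (fun u => κ u + wedge (G u) θ) (fun u v => by
    simp only [map_add, interior_wedge, hG u v]
    linear_combination (norm := module) hE u v) u
  exact eq_neg_of_add_eq_zero_left this

end SkewForm
end

/-! ### Covariant derivative of forms on an open set, curvature and the Ricci identity. -/

noncomputable section

namespace SkewForm

open ContinuousAlternatingMap (alternatizeUncurryFin alternatizeUncurryFinCLM)
open Filter Topology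

variable {E : Type*} [NormedAddCommGroup E] [NormedSpace ℝ E] {m n : ℕ}

/-- The covariant derivative of a form for the connection with Christoffel symbols `Γ`. -/
def cov (Γ : E → E →L[ℝ] E →L[ℝ] E) (φ : E → E [⋀^Fin m]→L[ℝ] ℝ) (e : E) :
    E →L[ℝ] E [⋀^Fin m]→L[ℝ] ℝ :=
  fderiv ℝ φ e - act.flip (φ e) ∘L Γ e

variable {Γ : E → E →L[ℝ] E →L[ℝ] E} {φ φ' : E → E [⋀^Fin m]→L[ℝ] ℝ} {e : E}

theorem cov_apply (u : E) : cov Γ φ e u = fderiv ℝ φ e u - act (Γ e u) (φ e) := rfl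

theorem cov_congr (h : φ =ᶠ[𝓝 e] φ') : cov Γ φ e = cov Γ φ' e := by
  rw [cov, cov, h.fderiv_eq, h.eq_of_nhds]

theorem cov_add (h : DifferentiableAt ℝ φ e) (h' : DifferentiableAt ℝ φ' e) (u : E) :
    cov Γ (fun x => φ x + φ' x) e u = cov Γ φ e u + cov Γ φ' e u := by
  simp only [cov_apply, fderiv_fun_add h h', map_add, add_apply]
  abel

theorem cov_sub (h : DifferentiableAt ℝ φ e) (h' : DifferentiableAt ℝ φ' e) (u : E) :
    cov Γ (fun x => φ x - φ' x) e u = cov Γ φ e u - cov Γ φ' e u := by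
  simp only [cov_apply, fderiv_fun_sub h h', map_sub, sub_apply]
  abel

theorem cov_smul (r : ℝ) (h : DifferentiableAt ℝ φ e) (u : E) :
    cov Γ (fun x => r • φ x) e u = r • cov Γ φ e u := by
  simp only [cov_apply, fderiv_fun_const_smul h, map_smul, smul_apply, smul_sub]

theorem cov_neg (u : E) : cov Γ (fun x => -φ x) e u = -cov Γ φ e u := by
  simp only [cov_apply, fderiv_fun_neg, map_neg, neg_apply]
  abel

theorem cov_interior {φ : E → E [⋀^Fin (m + 1)]→L[ℝ] ℝ} (h : DifferentiableAt ℝ φ e) (u v : E) :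
    cov Γ (fun x => interior v (φ x)) e u =
      interior v (cov Γ φ e u) + interior (Γ e u v) (φ e) := by
  have : fderiv ℝ (fun x => interior v (φ x)) e = (interior v) ∘L fderiv ℝ φ e :=
    ((interior v).hasFDerivAt.comp e h.hasFDerivAt).fderiv
  simp only [cov_apply, this, map_sub, interior_act, ContinuousLinearMap.comp_apply]
  abel

theorem hasFDerivAt_apply_const {V W : Type*} [NormedAddCommGroup V] [NormedSpace ℝ V]
    [NormedAddCommGroup W] [NormedSpace ℝ W] {F : E → V →L[ℝ] W} {F' : E →L[ℝ] V →L[ℝ] W}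
    (h : HasFDerivAt F F' e) (v : V) : HasFDerivAt (fun x => F x v) (F'.flip v) e := by
  simpa using h.clm_apply (hasFDerivAt_const v e)

theorem hasFDerivAt_wedge {α : E → E →L[ℝ] ℝ} {α' : E →L[ℝ] E →L[ℝ] ℝ}
    {dφ : E →L[ℝ] E [⋀^Fin m]→L[ℝ] ℝ} (hα : HasFDerivAt α α' e) (hφ : HasFDerivAt φ dφ e) :
    HasFDerivAt (fun x => wedge (α x) (φ x))
      (wedge (α e) ∘L dφ + wedge.flip (φ e) ∘L α') e :=
  ContinuousLinearMap.hasFDerivAt_of_bilinear (wedge (E := E) (m := m)) hα hφ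

theorem hasFDerivAt_act {T : E → E →L[ℝ] E} {T' : E →L[ℝ] E →L[ℝ] E}
    {dφ : E →L[ℝ] E [⋀^Fin m]→L[ℝ] ℝ} (hT : HasFDerivAt T T' e) (hφ : HasFDerivAt φ dφ e) :
    HasFDerivAt (fun x => act (T x) (φ x)) (act (T e) ∘L dφ + act.flip (φ e) ∘L T') e :=
  ContinuousLinearMap.hasFDerivAt_of_bilinear (act (E := E) (m := m)) hT hφ

theorem cov_wedge {G : E → E →L[ℝ] E →L[ℝ] ℝ} (hG : DifferentiableAt ℝ G e)
    (hc : ∀ u v w, fderiv ℝ G e u v w = G e (Γ e u v) w + G e v (Γ e u w))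
    (h : DifferentiableAt ℝ φ e) (u v : E) :
    cov Γ (fun x => wedge (G x v) (φ x)) e u =
      wedge (G e v) (cov Γ φ e u) + wedge (G e (Γ e u v)) (φ e) := by
  have h2 : fderiv ℝ (fun x => wedge (G x v) (φ x)) e u =
      wedge (G e v) (fderiv ℝ φ e u) + wedge (fderiv ℝ G e u v) (φ e) := by
    rw [(hasFDerivAt_wedge (hasFDerivAt_apply_const hG.hasFDerivAt v) h.hasFDerivAt).fderiv]
    rfl
  -- Metric compatibility: the second summand cancels the connection term acting on the covector `G
  -- e v`.
  have h3 : fderiv ℝ G e u v = G e (Γ e u v) + G e v ∘L Γ e u := by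
    ext w; simp [hc]
  simp only [cov_apply, h2, h3, act_wedge, map_add, map_sub, add_apply]
  abel

/-- The curvature of the connection with Christoffel symbols `Γ`. -/
def curv (Γ : E → E →L[ℝ] E →L[ℝ] E) (e u v : E) : E →L[ℝ] E :=
  fderiv ℝ Γ e u v - fderiv ℝ Γ e v u + Γ e u ∘L Γ e v - Γ e v ∘L Γ e u

theorem fderiv_cov (hΓ : DifferentiableAt ℝ Γ e) (h : ContDiffAt ℝ 2 φ e) (u v : E) :
    fderiv ℝ (fun x => cov Γ φ x v) e u = fderiv ℝ (fderiv ℝ φ) e u v -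
      act (Γ e v) (fderiv ℝ φ e u) - act (fderiv ℝ Γ e u v) (φ e) := by
  have hφ : DifferentiableAt ℝ φ e := h.differentiableAt (by norm_num)
  have hdφ : DifferentiableAt ℝ (fderiv ℝ φ) e :=
    (h.fderiv_right (m := 1) (by norm_num)).differentiableAt (by norm_num)
  have h1 : HasFDerivAt (fun x => cov Γ φ x v) _ e :=
    (hasFDerivAt_apply_const hdφ.hasFDerivAt v).sub
      (hasFDerivAt_act (hasFDerivAt_apply_const hΓ.hasFDerivAt v) hφ.hasFDerivAt)
  rw [h1.fderiv]
  exact (sub_sub _ _ _).symm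

theorem cov_cov_sub (hΓ : DifferentiableAt ℝ Γ e) (h : ContDiffAt ℝ 2 φ e) (u v : E) :
    cov Γ (fun x => cov Γ φ x v) e u - cov Γ (fun x => cov Γ φ x u) e v =
      -act (curv Γ e u v) (φ e) := by
  have hs : fderiv ℝ (fderiv ℝ φ) e u v = fderiv ℝ (fderiv ℝ φ) e v u :=
    (h.isSymmSndFDerivAt (by simp)).eq u v
  have ha := act_act_sub (Γ e u) (Γ e v) (φ e)
  rw [cov_apply, fderiv_cov hΓ h, cov_apply (φ := fun x => cov Γ φ x u), fderiv_cov hΓ h, hs, curv]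
  simp only [cov_apply, map_sub, map_add, sub_apply, add_apply] at ha ⊢
  linear_combination (norm := module) ha

theorem extDeriv_eq_alternatize_cov (hΓ : ∀ u v, Γ e u v = Γ e v u) :
    extDeriv φ e = alternatizeUncurryFin (cov Γ φ e) := by
  rw [cov, ← ContinuousAlternatingMap.alternatizeUncurryFinCLM_apply, map_sub,
    ContinuousAlternatingMap.alternatizeUncurryFinCLM_apply,
    ContinuousAlternatingMap.alternatizeUncurryFinCLM_apply, alternatize_act_of_symm _ hΓ, sub_zero]
  rfl

/-- On the open set `U`, `Γ` is the Levi-Civita connection of the nondegenerate metric `G` and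
the curvature is constant, equal to `lam`. -/
structure ConstCurvOn (n : ℕ) (U : Set E) (G : E → E →L[ℝ] E →L[ℝ] ℝ) (Γ : E → E →L[ℝ] E →L[ℝ] E)
    (lam : ℝ) : Prop where
  isOpen : IsOpen U
  diffMetric : DifferentiableOn ℝ G U
  smoothConn : ContDiffOn ℝ ∞ Γ U
  frame : ∀ e ∈ U, ∃ b c : Fin n → E, IsDualFrame (G e) b c
  symm : ∀ e ∈ U, ∀ u v, Γ e u v = Γ e v u
  compat : ∀ e ∈ U, ∀ u v w, fderiv ℝ G e u v w = G e (Γ e u v) w + G e v (Γ e u w)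
  curv_eq : ∀ e ∈ U, ∀ u v w, curv Γ e u v w = lam • (G e v w • u - G e u w • v)

namespace ConstCurvOn

variable {U : Set E} {G : E → E →L[ℝ] E →L[ℝ] ℝ} {lam : ℝ}

theorem ricci {φ : E → E [⋀^Fin (m + 1)]→L[ℝ] ℝ} (hU : ConstCurvOn n U G Γ lam) (he : e ∈ U)
    (h : ContDiffOn ℝ ∞ φ U) (u v : E) :
    cov Γ (fun x => cov Γ φ x v) e u - cov Γ (fun x => cov Γ φ x u) e v =
      lam • (wedge (G e u) (interior v (φ e)) - wedge (G e v) (interior u (φ e))) := by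
  have hc : curv Γ e u v = lam • ((G e v).smulRight u - (G e u).smulRight v) := by
    ext w; simp [hU.curv_eq e he]
  have hU' := hU.isOpen.mem_nhds he
  rw [cov_cov_sub ((hU.smoothConn.contDiffAt hU').differentiableAt (by simp))
    ((h.contDiffAt hU').of_le (WithTop.coe_le_coe.2 le_top)), hc]
  simp only [map_smul, map_sub, smul_apply, sub_apply, act_smulRight]
  module

theorem smooth_extDeriv (hU : ConstCurvOn n U G Γ lam) (h : ContDiffOn ℝ ∞ φ U) :
    ContDiffOn ℝ ∞ (extDeriv φ) U :=
  (alternatizeUncurryFinCLM ℝ E ℝ).contDiff.comp_contDiffOn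
    (h.fderiv_of_isOpen hU.isOpen (by simp))

theorem differentiableAt (hU : ConstCurvOn n U G Γ lam) (h : ContDiffOn ℝ ∞ φ U) (he : e ∈ U) :
    DifferentiableAt ℝ φ e :=
  (h.contDiffAt (hU.isOpen.mem_nhds he)).differentiableAt (by simp)

theorem eventually_of (hU : ConstCurvOn n U G Γ lam) (he : e ∈ U)
    (h : ∀ x ∈ U, φ x = φ' x) : φ =ᶠ[𝓝 e] φ' :=
  Filter.eventually_of_mem (hU.isOpen.mem_nhds he) h

end ConstCurvOn

end SkewForm
end

/-! ### Prolongation of the conformal Killing–Yano equation. -/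

noncomputable section

namespace SkewForm

open ContinuousAlternatingMap (alternatizeUncurryFin alternatizeUncurryFinCLM)

variable {E : Type*} [NormedAddCommGroup E] [NormedSpace ℝ E] {m n k : ℕ}
  {Γ : E → E →L[ℝ] E →L[ℝ] E} {e : E}

theorem cov_zero (u : E) : cov Γ (fun _ => (0 : E [⋀^Fin m]→L[ℝ] ℝ)) e u = 0 := by
  simp [cov_apply]

namespace ConstCurvOn

variable {U : Set E} {G : E → E →L[ℝ] E →L[ℝ] ℝ} {lam : ℝ}

theorem metric_symm (hU : ConstCurvOn n U G Γ lam) (he : e ∈ U) (u v : E) :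
    G e u v = G e v u := by
  obtain ⟨b, c, h⟩ := hU.frame e he
  exact h.symm u v

/-- Differentiate the equation for `φ`, antisymmetrize and apply `ricci`. The vectors `u`, `v` are
constant in coordinates, not parallel; the resulting terms in `Γ e u v` are symmetric and cancel. -/
theorem integrability (hU : ConstCurvOn n U G Γ lam) {φ : E → E [⋀^Fin (m + 1)]→L[ℝ] ℝ}
    {A : E → E [⋀^Fin (m + 2)]→L[ℝ] ℝ} {B : E → E [⋀^Fin m]→L[ℝ] ℝ}
    (hφ : ContDiffOn ℝ ∞ φ U) (hA : ContDiffOn ℝ ∞ A U) (hB : ContDiffOn ℝ ∞ B U)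
    (h : ∀ x ∈ U, ∀ u, cov Γ φ x u = interior u (A x) + wedge (G x u) (B x))
    (he : e ∈ U) (u v : E) :
    interior v (cov Γ A e u) - interior u (cov Γ A e v) + wedge (G e v) (cov Γ B e u) -
        wedge (G e u) (cov Γ B e v) =
      lam • (wedge (G e u) (interior v (φ e)) - wedge (G e v) (interior u (φ e))) := by
  have hGd : DifferentiableAt ℝ G e := (hU.diffMetric e he).differentiableAt (hU.isOpen.mem_nhds he)
  have hAd := hU.differentiableAt hA he
  have hBd := hU.differentiableAt hB he
  have key : ∀ u v, cov Γ (fun x => cov Γ φ x v) e u =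
      interior v (cov Γ A e u) + interior (Γ e u v) (A e) +
        (wedge (G e v) (cov Γ B e u) + wedge (G e (Γ e u v)) (B e)) := by
    intro u v
    have hw : DifferentiableAt ℝ (fun x => wedge (G x v) (B x)) e :=
      (hasFDerivAt_wedge (hasFDerivAt_apply_const hGd.hasFDerivAt v)
        hBd.hasFDerivAt).differentiableAt
    have hi : DifferentiableAt ℝ (fun x => interior v (A x)) e :=
      (interior v).differentiableAt.comp e hAd
    rw [cov_congr (hU.eventually_of he fun x hx => h x hx v), cov_add hi hw, cov_interior hAd,
      cov_wedge hGd (hU.compat e he) hBd]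
  rw [← hU.ricci he hφ, key, key, hU.symm e he v u]
  abel

/-- The conformal Killing-Yano equation for `y`, up to the scaling of `η`. -/
def CKYOn (U : Set E) (G : E → E →L[ℝ] E →L[ℝ] ℝ) (Γ : E → E →L[ℝ] E →L[ℝ] E)
    (y : E → E [⋀^Fin (k + 1)]→L[ℝ] ℝ) (η : E → E [⋀^Fin k]→L[ℝ] ℝ) : Prop :=
  ∀ e ∈ U, ∀ u v, interior v (cov Γ y e u) + interior u (cov Γ y e v) =
    interior v (wedge (G e u) (η e)) + interior u (wedge (G e v) (η e))

variable {y : E → E [⋀^Fin (k + 1)]→L[ℝ] ℝ} {η : E → E [⋀^Fin k]→L[ℝ] ℝ}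

theorem cov_eq_of_cky (hU : ConstCurvOn n U G Γ lam) (h : CKYOn U G Γ y η) (he : e ∈ U) (u : E) :
    cov Γ y e u =
      interior u ((k + 2 : ℝ)⁻¹ • extDeriv y e) + wedge (G e u) (η e) := by
  set f : E →L[ℝ] E [⋀^Fin (k + 1)]→L[ℝ] ℝ := cov Γ y e - wedge.flip (η e) ∘L G e with hf
  have hfu : ∀ u, f u = cov Γ y e u - wedge (G e u) (η e) := fun _ => rfl
  have h1 : alternatizeUncurryFin f = extDeriv y e := by
    rw [hf, ← ContinuousAlternatingMap.alternatizeUncurryFinCLM_apply, map_sub,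
      ContinuousAlternatingMap.alternatizeUncurryFinCLM_apply,
      ContinuousAlternatingMap.alternatizeUncurryFinCLM_apply,
      alternatize_wedge_of_symm _ (hU.metric_symm he), sub_zero,
      extDeriv_eq_alternatize_cov (hU.symm e he)]
  have h2 := interior_alternatize_of_skew f (fun u v => by
    rw [hfu, hfu, map_sub, map_sub]
    linear_combination (norm := module) h e he u v) u
  have hk : (k + 2 : ℝ) ≠ 0 := by positivity
  rw [map_smul, ← h1, h2, smul_smul, inv_mul_cancel₀ hk, one_smul, hfu]
  abel

theorem cov_divergence_eq (hU : ConstCurvOn n U G Γ lam) (hkn : k + 1 < n)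
    (hy : ContDiffOn ℝ ∞ y U) (hη : ContDiffOn ℝ ∞ η U) (h : CKYOn U G Γ y η) (he : e ∈ U) (u : E) :
    cov Γ η e u = (k + 1 : ℝ)⁻¹ • interior u (extDeriv η e) := by
  rw [extDeriv_eq_alternatize_cov (hU.symm e he)]
  have hK : ContDiffOn ℝ ∞ (fun x => (k + 2 : ℝ)⁻¹ • extDeriv y x) U :=
    (hU.smooth_extDeriv hy).const_smul _
  have hI := fun u v => hU.integrability hy hK hη (fun x hx u => hU.cov_eq_of_cky h hx u) he u v
  cases k with
  | zero => simp [interior_alternatize_zero]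
  | succ m =>
    obtain ⟨b, c, hF⟩ := hU.frame e he
    -- The curvature term is absorbed into `θ u = ∇_u η + lam • ι_u y`. Its second summand is
    -- already skew, so skewness of `θ` passes to `∇η`.
    have hs := hF.skew_of_integrability hkn (cov Γ (fun x => _ • extDeriv y x) e)
      (cov Γ η e + lam • interior.flip (y e)) (fun u v => by
        simp only [add_apply, smul_apply, ContinuousLinearMap.flip_apply, map_add, map_smul]
        linear_combination (norm := module) hI u v)
    have hs' : ∀ u v, interior v (cov Γ η e u) = -interior u (cov Γ η e v) := by
      intro u v
      have := hs u v
      simp only [add_apply, smul_apply, ContinuousLinearMap.flip_apply, map_add, map_smul,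
        interior_comm (y e) u v] at this
      linear_combination (norm := module) this
    have hm : ((m + 1 : ℕ) + 1 : ℝ) = m + 2 := by push_cast; ring
    have hm' : (m + 2 : ℝ) ≠ 0 := by positivity
    rw [interior_alternatize_of_skew _ hs', hm, smul_smul, inv_mul_cancel₀ hm', one_smul]

theorem cov_killing_part (hU : ConstCurvOn n U G Γ lam) (hkn : k + 1 < n)
    (hnk : ¬ (n = 2 ∧ k = 0)) (hy : ContDiffOn ℝ ∞ y U) (hη : ContDiffOn ℝ ∞ η U)
    (h : CKYOn U G Γ y η) (he : e ∈ U) (u : E) :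
    cov Γ (fun x => lam • y x + (k + 1 : ℝ)⁻¹ • extDeriv η x) e u =
      lam • interior u ((k + 2 : ℝ)⁻¹ • extDeriv y e) := by
  set K := fun x => (k + 2 : ℝ)⁻¹ • extDeriv y x with hKdef
  set Θ := fun x => lam • y x + (k + 1 : ℝ)⁻¹ • extDeriv η x with hΘdef
  have hK : ContDiffOn ℝ ∞ K U := (hU.smooth_extDeriv hy).const_smul _
  have hΘ : ContDiffOn ℝ ∞ Θ U :=
    (hy.const_smul _).add ((hU.smooth_extDeriv hη).const_smul _)
  have hcy : ∀ x ∈ U, ∀ u, cov Γ y x u = interior u (K x) + wedge (G x u) (η x) :=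
    fun x hx u => hU.cov_eq_of_cky h hx u
  have hcη : ∀ x ∈ U, ∀ u, cov Γ η x u = interior u (Θ x - lam • y x) := by
    intro x hx u
    rw [hU.cov_divergence_eq hkn hy hη h hx, hΘdef, add_sub_cancel_left, map_smul]
  have hz : ∀ {m : ℕ}, ContDiffOn ℝ ∞ (fun _ : E => (0 : E [⋀^Fin m]→L[ℝ] ℝ)) U :=
    contDiffOn_const
  have hyd := hU.differentiableAt hy he
  have hΘd := hU.differentiableAt hΘ he
  suffices hψ : cov Γ Θ e u - lam • interior u (K e) = 0 from sub_eq_zero.1 hψ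
  cases k with
  | zero =>
    obtain ⟨b, c, hF⟩ := hU.frame e he
    -- For one-forms, the integrability of `y` determines `∇K = -u♭ ∧ Θ`. This is again an equation
    -- of the standard shape, with `A = 0` and `B = -Θ`, so `integrability` applies to `K`.
    have hcK : ∀ x ∈ U, ∀ u, cov Γ K x u =
        interior u ((fun _ => 0 : E → E [⋀^Fin 3]→L[ℝ] ℝ) x) + wedge (G x u) (-Θ x) := by
      intro x hx u
      rw [eq_neg_wedge_of_integrability (G x) (hU.metric_symm hx) (cov Γ K x) (Θ x) (fun u v => by
        have h1 := hU.integrability hy hK hη hcy hx u v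
        rw [hcη x hx, hcη x hx] at h1
        simp only [map_sub, map_smul] at h1
        linear_combination (norm := module) h1)]
      simp
    have hI := fun u v => hU.integrability hK hz hΘ.neg hcK he u v
    -- Here `2 < n` is needed; it follows from `1 < n` and the exclusion of `n = 2`.
    have hψ0 := hF.eq_zero_of_wedge_symm (m := 0) (by omega)
      (cov Γ Θ e - lam • interior.flip (K e)) (fun u v => by
        have h1 := hI u v
        rw [cov_zero, cov_zero] at h1
        simp only [cov_neg, map_neg, map_zero] at h1
        simp only [sub_apply, smul_apply, ContinuousLinearMap.flip_apply, map_sub, map_smul]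
        linear_combination (norm := module) h1)
    exact congrArg (fun f => f u) hψ0
  | succ m =>
    have hA : ContDiffOn ℝ ∞ (fun x => Θ x - lam • y x) U := hΘ.sub (hy.const_smul _)
    have hI := fun u v => hU.integrability (B := fun _ => 0) hη hA hz
      (fun x hx u => by rw [hcη x hx, map_zero, add_zero]) he u v
    have hcA : ∀ u, cov Γ (fun x => Θ x - lam • y x) e u =
        cov Γ Θ e u - lam • (interior u (K e) + wedge (G e u) (η e)) := by
      intro u
      rw [cov_sub hΘd (hyd.fun_const_smul lam), cov_smul _ hyd, hcy e he]
    -- The terms `lam • u♭ ∧ η` from `∇y` cancel the curvature terms of `η`, leaving the symmetry of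
    -- `∇_u Θ - lam • ι_u K`.
    refine eq_zero_of_interior_symm (fun u => cov Γ Θ e u - lam • interior u (K e))
      (fun u v => ?_) u
    have h1 := hI u v
    rw [hcA, hcA, cov_zero, cov_zero] at h1
    simp only [map_sub, map_smul, map_add, interior_wedge, map_zero,
      hU.metric_symm he u v] at h1 ⊢
    linear_combination (norm := module) h1

theorem cov_extDeriv_divergence (hU : ConstCurvOn n U G Γ lam) (hkn : k + 1 < n)
    (hnk : ¬ (n = 2 ∧ k = 0)) (hy : ContDiffOn ℝ ∞ y U) (hη : ContDiffOn ℝ ∞ η U)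
    (h : CKYOn U G Γ y η) (he : e ∈ U) (u : E) :
    cov Γ (extDeriv η) e u = -(lam * (k + 1)) • wedge (G e u) (η e) := by
  have h1 := hU.cov_killing_part hkn hnk hy hη h he u
  have hyd := hU.differentiableAt hy he
  have hηd := hU.differentiableAt (hU.smooth_extDeriv hη) he
  rw [cov_add (hyd.fun_const_smul lam) (hηd.fun_const_smul _), cov_smul _ hyd, cov_smul _ hηd,
    hU.cov_eq_of_cky h he] at h1
  have hk : (k + 1 : ℝ) ≠ 0 := by positivity
  have h2 : (k + 1 : ℝ)⁻¹ • cov Γ (extDeriv η) e u = -lam • wedge (G e u) (η e) := by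
    linear_combination (norm := module) h1
  rw [inv_smul_eq_iff₀ hk] at h2
  rw [h2, smul_smul]
  congr 1
  ring

theorem sum_interior_cov (hU : ConstCurvOn n U G Γ lam) (h : CKYOn U G Γ y η) (he : e ∈ U)
    {b c : Fin n → E} (hF : IsDualFrame (G e) b c) :
    ∑ i, interior (c i) (cov Γ y e (b i)) = ((n : ℝ) - k) • η e := by
  simp only [hU.cov_eq_of_cky h he, map_add, Finset.sum_add_distrib, hF.sum_interior_interior,
    hF.sum_interior_wedge, zero_add]

end ConstCurvOn

end SkewForm
end

/-! ### The Levi-Civita connection in a chart and translation of the tensor equations. -/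

noncomputable section

open ContinuousAlternatingMap (alternatizeUncurryFin)
open SkewForm SkewForm.ConstCurvOn

namespace SkewForm

variable {E : Type*} [NormedAddCommGroup E] [NormedSpace ℝ E]

set_option maxSynthPendingDepth 3 in
/-- The Levi-Civita connection of the metric `G`. -/
def leviCivita (G : E → E →L[ℝ] E →L[ℝ] ℝ) (e : E) : E →L[ℝ] E →L[ℝ] E :=
  (ContinuousLinearMap.compL ℝ E (E →L[ℝ] ℝ) E (G e).inverse) ∘L
    ((1 / 2 : ℝ) • (fderiv ℝ G e + (fderiv ℝ G e).flip -
      ((ContinuousLinearMap.flipₗᵢ ℝ E E ℝ).toContinuousLinearEquiv :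
        (E →L[ℝ] E →L[ℝ] ℝ) →L[ℝ] (E →L[ℝ] E →L[ℝ] ℝ)) ∘L (fderiv ℝ G e).flip))

variable {G : E → E →L[ℝ] E →L[ℝ] ℝ} {U : Set E}

theorem contDiffOn_inverse [CompleteSpace E] (hG : ContDiffOn ℝ ∞ G U)
    (hi : ∀ e ∈ U, (G e).IsInvertible) : ContDiffOn ℝ ∞ (fun e => (G e).inverse) U := by
  intro e he
  obtain ⟨L, hL⟩ := hi e he
  have h1 : ContDiffAt ℝ ∞ ContinuousLinearMap.inverse (G e) := by
    rw [← hL]; exact contDiffAt_map_inverse L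
  exact h1.comp_contDiffWithinAt e (hG e he)

set_option maxSynthPendingDepth 3 in
theorem contDiffOn_leviCivita [CompleteSpace E] (hU : IsOpen U) (hG : ContDiffOn ℝ ∞ G U)
    (hi : ∀ e ∈ U, (G e).IsInvertible) : ContDiffOn ℝ ∞ (leviCivita G) U := by
  have hd : ContDiffOn ℝ ∞ (fderiv ℝ G) U := hG.fderiv_of_isOpen hU (by simp)
  have hf : ContDiffOn ℝ ∞ (fun e => (fderiv ℝ G e).flip) U :=
    (ContinuousLinearMap.flipₗᵢ ℝ E E (E →L[ℝ] ℝ)).contDiff.comp_contDiffOn hd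
  have h1 : ContDiffOn ℝ ∞
      (fun e => ContinuousLinearMap.compL ℝ E (E →L[ℝ] ℝ) E (G e).inverse) U :=
    (ContinuousLinearMap.compL ℝ E (E →L[ℝ] ℝ) E).contDiff.comp_contDiffOn
      (contDiffOn_inverse hG hi)
  exact h1.clm_comp (((hd.add hf).sub (contDiffOn_const.clm_comp hf)).const_smul (1 / 2 : ℝ))

end SkewForm

section Chart

variable {n : ℕ} {M : Type*} [TopologicalSpace M] [ChartedSpace (Coord n) M]

theorem chartFrame_isInvertible [IsManifold (𝓡 n) ∞ M] (x₀ : M) {e : Coord n}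
    (he : e ∈ (extChartAt (𝓡 n) x₀).target) : (chartFrame x₀ e).IsInvertible := by
  have h1 : IsManifold (𝓡 n) 1 M := IsManifold.of_le (n := ∞) (by simp)
  have := isInvertible_mfderivWithin_extChartAt_symm (I := 𝓡 n) he
  rw [ModelWithCorners.range_eq_univ, mfderivWithin_univ] at this
  exact this

end Chart

namespace PseudoRiemannianMetric

variable {n : ℕ} {M : Type*} [TopologicalSpace M] [ChartedSpace (Coord n) M]
  (g : PseudoRiemannianMetric n M) (x₀ : M)

theorem inChart_symm (e u v : Coord n) : g.inChart x₀ e u v = g.inChart x₀ e v u :=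
  g.symm _ _ _

theorem inChart_nondegenerate [IsManifold (𝓡 n) ∞ M] {e : Coord n}
    (he : e ∈ (extChartAt (𝓡 n) x₀).target) {u : Coord n}
    (hu : ∀ v, g.inChart x₀ e u v = 0) : u = 0 := by
  have hi := chartFrame_isInvertible x₀ he
  have h0 : chartFrame x₀ e u = 0 := by
    refine g.nondegenerate _ _ fun w => ?_
    obtain ⟨v, rfl⟩ := hi.bijective.2 w
    exact hu v
  exact hi.bijective.1 (by rw [h0, map_zero])

theorem inChart_isInvertible [IsManifold (𝓡 n) ∞ M] {e : Coord n}
    (he : e ∈ (extChartAt (𝓡 n) x₀).target) : (g.inChart x₀ e).IsInvertible := by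
  have hinj : Function.Injective (g.inChart x₀ e).toLinearMap := by
    rw [← LinearMap.ker_eq_bot, LinearMap.ker_eq_bot']
    exact fun u hu => g.inChart_nondegenerate x₀ he fun v => congrArg (fun f => f v) hu
  have hfin : Module.finrank ℝ (Coord n) = Module.finrank ℝ (Coord n →L[ℝ] ℝ) := by
    rw [← (LinearMap.toContinuousLinearMap (𝕜 := ℝ) (E := Coord n) (F' := ℝ)).finrank_eq]
    exact (Subspace.dual_finrank_eq).symm
  refine ⟨(LinearMap.linearEquivOfInjective _ hinj hfin).toContinuousLinearEquiv, ?_⟩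
  ext; rfl

theorem inChart_sharp [IsManifold (𝓡 n) ∞ M] {e : Coord n}
    (he : e ∈ (extChartAt (𝓡 n) x₀).target) (α : Coord n →L[ℝ] ℝ) :
    g.inChart x₀ e (g.sharp x₀ e α) = α := by
  obtain ⟨L, hL⟩ := g.inChart_isInvertible x₀ he
  rw [sharp, ← hL, ContinuousLinearMap.inverse_equiv]
  exact L.apply_symm_apply α

theorem isDualFrame [IsManifold (𝓡 n) ∞ M] {e : Coord n}
    (he : e ∈ (extChartAt (𝓡 n) x₀).target) :
    IsDualFrame (g.inChart x₀ e) (fun i => EuclideanSpace.single i (1 : ℝ))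
      (fun i => g.sharp x₀ e (EuclideanSpace.proj i)) := by
  have hs : ∀ (i : Fin n) (x : Coord n),
      g.inChart x₀ e x (g.sharp x₀ e (EuclideanSpace.proj i)) = x i := fun i x => by
    rw [g.inChart_symm, g.inChart_sharp x₀ he]; rfl
  have hx : ∀ x : Coord n, ∑ i, x i • (EuclideanSpace.single i (1 : ℝ) : Coord n) = x := by
    intro x
    ext j
    simp [Finset.sum_apply, Pi.single_apply]
  refine ⟨g.inChart_symm x₀ e, by simp [hs], fun x => ?_, fun x => by simp only [hs, hx]⟩
  refine sub_eq_zero.1 (g.inChart_nondegenerate x₀ he fun v => ?_)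
  have h1 : ∀ i, g.inChart x₀ e (g.sharp x₀ e (EuclideanSpace.proj i)) v = v i := fun i => by
    rw [g.inChart_symm, hs]
  have h2 : g.inChart x₀ e x v = ∑ i, v i * g.inChart x₀ e x (EuclideanSpace.single i 1) := by
    conv_lhs => rw [← hx v]
    simp [map_sum]
  rw [map_sub, sub_apply, h2]
  simp [map_sum, h1, mul_comm, g.inChart_symm x₀ e x]

theorem leviCivita_inChart (e u v : Coord n) :
    leviCivita (g.inChart x₀) e u v = g.christoffel x₀ e u v := rfl

theorem contDiffOn_leviCivita_inChart [IsManifold (𝓡 n) ∞ M] :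
    ContDiffOn ℝ ∞ (leviCivita (g.inChart x₀)) (extChartAt (𝓡 n) x₀).target :=
  contDiffOn_leviCivita (isOpen_extChartAt_target x₀) (g.smooth x₀)
    fun _ he => g.inChart_isInvertible x₀ he

theorem fderiv_inChart_symm [IsManifold (𝓡 n) ∞ M] {e : Coord n}
    (he : e ∈ (extChartAt (𝓡 n) x₀).target) (u v w : Coord n) :
    fderiv ℝ (g.inChart x₀) e u v w = fderiv ℝ (g.inChart x₀) e u w v := by
  have hd : DifferentiableAt ℝ (g.inChart x₀) e :=
    ((g.smooth x₀).contDiffAt ((isOpen_extChartAt_target x₀).mem_nhds he)).differentiableAt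
      (by simp)
  have h1 : ∀ v w, HasFDerivAt (fun x => g.inChart x₀ x v w)
      (((fderiv ℝ (g.inChart x₀) e).flip v).flip w) e := fun v w =>
    hasFDerivAt_apply_const (hasFDerivAt_apply_const hd.hasFDerivAt v) w
  have h2 := (h1 v w).unique ((h1 w v).congr_of_eventuallyEq
    (Filter.Eventually.of_forall fun x => g.inChart_symm x₀ x v w))
  exact congrArg (fun f => f u) h2

theorem constCurvOn [IsManifold (𝓡 n) ∞ M] {lam : ℝ} (hg : g.HasConstantCurvature lam) :
    ConstCurvOn n (extChartAt (𝓡 n) x₀).target (g.inChart x₀) (leviCivita (g.inChart x₀)) lam where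
  isOpen := isOpen_extChartAt_target x₀
  diffMetric := (g.smooth x₀).differentiableOn (by simp)
  smoothConn := g.contDiffOn_leviCivita_inChart x₀
  frame e he := ⟨_, _, g.isDualFrame x₀ he⟩
  symm e he u v := by
    have hs := g.fderiv_inChart_symm x₀ he
    rw [leviCivita_inChart, leviCivita_inChart, christoffel, christoffel]
    congr 1
    ext w
    simp only [christoffelFirst, smul_apply, sub_apply, add_apply,
      ContinuousLinearMap.flip_apply, smul_eq_mul, hs w u v]
    ring
  compat e he u v w := by
    have hs := g.fderiv_inChart_symm x₀ he
    rw [leviCivita_inChart, leviCivita_inChart, g.inChart_symm x₀ e v, christoffel, christoffel,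
      g.inChart_sharp x₀ he, g.inChart_sharp x₀ he]
    simp only [christoffelFirst, smul_apply, sub_apply, add_apply,
      ContinuousLinearMap.flip_apply, smul_eq_mul, hs u w v, hs w u v, hs v u w]
    ring
  curv_eq e he u v w := by
    have hΓ : DifferentiableAt ℝ (leviCivita (g.inChart x₀)) e :=
      ((g.contDiffOn_leviCivita_inChart x₀).contDiffAt
        ((isOpen_extChartAt_target x₀).mem_nhds he)).differentiableAt (by simp)
    have hd : ∀ a b c, fderiv ℝ (fun x => g.christoffel x₀ x a b) e c =
        fderiv ℝ (leviCivita (g.inChart x₀)) e c a b := fun a b c => by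
      have h1 : HasFDerivAt (fun x => g.christoffel x₀ x a b) _ e :=
        hasFDerivAt_apply_const (hasFDerivAt_apply_const hΓ.hasFDerivAt a) b
      rw [h1.fderiv]; rfl
    have hcurv : curv (leviCivita (g.inChart x₀)) e u v w = g.curvature x₀ e u v w := by
      rw [curvature, hd, hd]; rfl
    refine sub_eq_zero.1 (g.inChart_nondegenerate x₀ he fun c => ?_)
    have h2 := hg x₀ e he u v c w
    rw [riemann, ← hcurv] at h2
    simp only [map_sub, map_smul, sub_apply, smul_apply, smul_eq_mul, h2]
    ring

theorem nabla_eq_cov {p : ℕ} (Y : FormField n p M) (e u : Coord n) (v : Fin p → Coord n) :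
    g.nabla Y x₀ e u v = cov (leviCivita (g.inChart x₀)) (Y.inChart x₀) e u v := by
  rw [cov_apply, ContinuousAlternatingMap.sub_apply, act_apply]; rfl

theorem metricWedge_eq {k : ℕ} (h : FormField n k M) (e a : Coord n) (b : Fin (k + 1) → Coord n) :
    g.metricWedge h x₀ e a b = (k + 1 : ℝ)⁻¹ * wedge (g.inChart x₀ e a) (h.inChart x₀ e) b :=
  antisymmetrize_eq_alternatize ((g.inChart x₀ e a).smulRight (h.inChart x₀ e)) b

/-- The weight-one antisymmetrization is `(k+1)⁻¹` times `wedge`; with the 2 of the CKY equation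
this gives the factor in `η = 2h/(k+1)`. -/
theorem isCKYWith_iff {k : ℕ} (Y : FormField n (k + 1) M) (h : FormField n k M) :
    g.IsCKYWith Y h ↔ Y.IsSmooth ∧ h.IsSmooth ∧ ∀ x₀ : M,
      CKYOn (extChartAt (𝓡 n) x₀).target (g.inChart x₀) (leviCivita (g.inChart x₀)) (Y.inChart x₀)
        (fun e => (2 / (k + 1) : ℝ) • h.inChart x₀ e) := by
  refine and_congr_right fun _ => and_congr_right fun _ => forall_congr' fun x₀ =>
    forall_congr' fun e => forall_congr' fun he => forall_congr' fun a => forall_congr' fun b₁ => ?_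
  rw [ContinuousAlternatingMap.ext_iff]
  refine forall_congr' fun b => ?_
  simp only [nabla_eq_cov, metricWedge_eq, map_smul, ContinuousAlternatingMap.add_apply,
    ContinuousAlternatingMap.smul_apply, interior_apply, smul_eq_mul]
  ring_nf

end PseudoRiemannianMetric
end

/-! ### The exterior derivative as a global tensor field. -/

noncomputable section

open ContinuousAlternatingMap (alternatizeUncurryFin)
open SkewForm SkewForm.ConstCurvOn
open Filter Topology

namespace FormField

variable {n p : ℕ} {M : Type*} [TopologicalSpace M] [ChartedSpace (Coord n) M]

theorem zero_inChart (x₀ : M) (e : Coord n) : (0 : FormField n p M).inChart x₀ e = 0 := rfl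

theorem smul_inChart (c : ℝ) (Y : FormField n p M) (x₀ : M) (e : Coord n) :
    (c • Y).inChart x₀ e = c • Y.inChart x₀ e := rfl

/-- The exterior derivative of a skew-symmetric tensor field. -/
def extDerivField (h : FormField n p M) : FormField n (p + 1) M := fun x =>
  (extDeriv (h.inChart x) (extChartAt (𝓡 n) x x)).compContinuousLinearMap
    (mfderiv (𝓡 n) 𝓘(ℝ, Coord n) (extChartAt (𝓡 n) x) x)

theorem pullback_congr (h : FormField n p M) {ψ ψ' : Coord n → M} {e : Coord n}
    (hψ : ψ =ᶠ[𝓝 e] ψ') :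
    ((h (ψ e)).compContinuousLinearMap (mfderiv 𝓘(ℝ, Coord n) (𝓡 n) ψ e) :
      Coord n [⋀^Fin p]→L[ℝ] ℝ) =
    (h (ψ' e)).compContinuousLinearMap (mfderiv 𝓘(ℝ, Coord n) (𝓡 n) ψ' e) := by
  -- All tangent spaces are definitionally `Coord n`; forgetting the dependence on the base point
  -- permits rewriting `ψ e`.
  let h' : M → Coord n [⋀^Fin p]→L[ℝ] ℝ := h
  have h1 : h' (ψ e) = h' (ψ' e) := congrArg h' hψ.eq_of_nhds
  have h2 : (mfderiv 𝓘(ℝ, Coord n) (𝓡 n) ψ e : Coord n →L[ℝ] Coord n) =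
      mfderiv 𝓘(ℝ, Coord n) (𝓡 n) ψ' e := hψ.mfderiv_eq
  exact congrArg₂ ContinuousAlternatingMap.compContinuousLinearMap h1 h2

theorem inChart_coordChange [IsManifold (𝓡 n) ∞ M] (h : FormField n p M) (x₀ x : M) {e : Coord n}
    (he : e ∈ (extChartAt (𝓡 n) x₀).target)
    (hx : (extChartAt (𝓡 n) x₀).symm e ∈ (extChartAt (𝓡 n) x).source) :
    h.inChart x₀ e =
      (h.inChart x (extChartAt (𝓡 n) x ((extChartAt (𝓡 n) x₀).symm e))).compContinuousLinearMap
        (fderiv ℝ (extChartAt (𝓡 n) x ∘ (extChartAt (𝓡 n) x₀).symm) e) := by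
  have hM : IsManifold (𝓡 n) 1 M := IsManifold.of_le (n := ∞) (by simp)
  have hs : MDifferentiableAt 𝓘(ℝ, Coord n) (𝓡 n) (extChartAt (𝓡 n) x₀).symm e :=
    (mdifferentiableOn_extChartAt_symm e he).mdifferentiableAt
      ((isOpen_extChartAt_target x₀).mem_nhds he)
  have hc : MDifferentiableAt (𝓡 n) 𝓘(ℝ, Coord n) (extChartAt (𝓡 n) x)
      ((extChartAt (𝓡 n) x₀).symm e) :=
    mdifferentiableAt_extChartAt (by rwa [extChartAt_source] at hx)
  have hτ : MDifferentiableAt 𝓘(ℝ, Coord n) 𝓘(ℝ, Coord n)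
      (extChartAt (𝓡 n) x ∘ (extChartAt (𝓡 n) x₀).symm) e := hc.comp e hs
  have ht := (extChartAt (𝓡 n) x).map_source hx
  have hsx : MDifferentiableAt 𝓘(ℝ, Coord n) (𝓡 n) (extChartAt (𝓡 n) x).symm
      ((extChartAt (𝓡 n) x ∘ (extChartAt (𝓡 n) x₀).symm) e) :=
    (mdifferentiableOn_extChartAt_symm _ ht).mdifferentiableAt
      ((isOpen_extChartAt_target x).mem_nhds ht)
  have hev : (extChartAt (𝓡 n) x₀).symm =ᶠ[𝓝 e] (extChartAt (𝓡 n) x).symm ∘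
      (extChartAt (𝓡 n) x ∘ (extChartAt (𝓡 n) x₀).symm) := by
    have := hs.continuousAt.preimage_mem_nhds ((isOpen_extChartAt_source x).mem_nhds hx)
    filter_upwards [this] with y hy
    exact ((extChartAt (𝓡 n) x).left_inv hy).symm
  refine (pullback_congr h hev).trans ?_
  rw [mfderiv_comp e hsx hτ, mfderiv_eq_fderiv]
  rfl

/-- The field is defined at each point through that point's own preferred chart; naturality of `d`
under the transition map `τ` makes it agree with `d` in any fixed chart. -/
theorem extDerivField_inChart [IsManifold (𝓡 n) ∞ M] {h : FormField n p M} (hh : h.IsSmooth)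
    (x₀ : M) {e : Coord n} (he : e ∈ (extChartAt (𝓡 n) x₀).target) :
    h.extDerivField.inChart x₀ e = extDeriv (h.inChart x₀) e := by
  have hM : IsManifold (𝓡 n) 1 M := IsManifold.of_le (n := ∞) (by simp)
  set x := (extChartAt (𝓡 n) x₀).symm e with hx
  set τ := extChartAt (𝓡 n) x ∘ (extChartAt (𝓡 n) x₀).symm with hτdef
  have hxs : x ∈ (extChartAt (𝓡 n) x).source := mem_extChartAt_source x
  have hs : MDifferentiableAt 𝓘(ℝ, Coord n) (𝓡 n) (extChartAt (𝓡 n) x₀).symm e :=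
    (mdifferentiableOn_extChartAt_symm e he).mdifferentiableAt
      ((isOpen_extChartAt_target x₀).mem_nhds he)
  have hc : MDifferentiableAt (𝓡 n) 𝓘(ℝ, Coord n) (extChartAt (𝓡 n) x) x :=
    mdifferentiableAt_extChartAt (mem_chart_source _ x)
  have hτ : ContDiffAt ℝ ∞ τ e := by
    rw [← contMDiffAt_iff_contDiffAt]
    have h1 : ContMDiffAt (𝓡 n) 𝓘(ℝ, Coord n) ∞ (extChartAt (𝓡 n) x) x := contMDiffAt_extChartAt
    exact h1.comp e ((contMDiffOn_extChartAt_symm x₀ e he).contMDiffAt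
      ((isOpen_extChartAt_target x₀).mem_nhds he))
  have hev : h.inChart x₀ =ᶠ[𝓝 e]
      fun y => (h.inChart x (τ y)).compContinuousLinearMap (fderiv ℝ τ y) := by
    have := hs.continuousAt.preimage_mem_nhds ((isOpen_extChartAt_source x).mem_nhds hxs)
    filter_upwards [this, (isOpen_extChartAt_target x₀).mem_nhds he] with y hy hy'
    exact inChart_coordChange h x₀ x hy' hy
  have hd : DifferentiableAt ℝ (h.inChart x) (τ e) :=
    ((hh x).contDiffAt ((isOpen_extChartAt_target x).mem_nhds
      (mem_extChartAt_target x))).differentiableAt (by simp)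
  have hdτ : fderiv ℝ τ e = ((mfderiv (𝓡 n) 𝓘(ℝ, Coord n) (extChartAt (𝓡 n) x) x :
      Coord n →L[ℝ] Coord n)) ∘L (chartFrame x₀ e : Coord n →L[ℝ] Coord n) := by
    rw [← mfderiv_eq_fderiv]
    exact mfderiv_comp e hc hs
  rw [hev.extDeriv_eq, extDeriv_pullback hd hτ (by
    rw [minSmoothness_of_isRCLikeNormedField]; exact WithTop.coe_le_coe.2 le_top), hdτ]
  rfl

theorem IsSmooth.extDerivField [IsManifold (𝓡 n) ∞ M] {h : FormField n p M} (hh : h.IsSmooth) :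
    h.extDerivField.IsSmooth := fun x₀ =>
  have h1 : ContDiffOn ℝ ∞ (extDeriv (h.inChart x₀)) (extChartAt (𝓡 n) x₀).target :=
    (ContinuousAlternatingMap.alternatizeUncurryFinCLM ℝ (Coord n) ℝ).contDiff.comp_contDiffOn
      ((hh x₀).fderiv_of_isOpen (isOpen_extChartAt_target x₀) (by simp))
  h1.congr fun _ he => extDerivField_inChart hh x₀ he

end FormField
end

/-! ### The Killing–Yano and closed parts, and the decomposition. -/

noncomputable section

open ContinuousAlternatingMap (alternatizeUncurryFin)
open SkewForm SkewForm.ConstCurvOn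

theorem SkewForm.eq_zero_of_finrank_lt {E : Type*} [NormedAddCommGroup E] [NormedSpace ℝ E]
    [FiniteDimensional ℝ E] {m : ℕ} (hm : Module.finrank ℝ E < m) (φ : E [⋀^Fin m]→L[ℝ] ℝ) :
    φ = 0 := by
  ext v
  refine φ.toAlternatingMap.map_linearDependent v fun hv => ?_
  have := hv.fintype_card_le_finrank
  simp at this
  omega

namespace PseudoRiemannianMetric

variable {n k : ℕ} {M : Type*} [TopologicalSpace M] [ChartedSpace (Coord n) M]
  (g : PseudoRiemannianMetric n M)

theorem antisymmetrize_nabla {p : ℕ} (Y : FormField n p M) (x₀ : M) (e : Coord n)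
    (v : Fin (p + 1) → Coord n) :
    antisymmetrize (fun w : Fin (p + 1) → Coord n => g.nabla Y x₀ e (w 0) (Fin.tail w)) v =
      (p + 1 : ℝ)⁻¹ * alternatizeUncurryFin (cov (leviCivita (g.inChart x₀)) (Y.inChart x₀) e) v := by
  simp only [nabla_eq_cov]
  exact antisymmetrize_eq_alternatize _ v

theorem _root_.FormField.isSmooth_zero {p : ℕ} : (0 : FormField n p M).IsSmooth := fun x₀ =>
  (contDiffOn_const (c := (0 : Coord n [⋀^Fin p]→L[ℝ] ℝ))).congr
    fun e _ => FormField.zero_inChart x₀ e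

theorem isKY_zero : g.IsKY (0 : FormField n (k + 1) M) := by
  refine (g.isCKYWith_iff _ _).2 ⟨FormField.isSmooth_zero, FormField.isSmooth_zero,
    fun x₀ e _ u v => ?_⟩
  have h0 : ∀ u, cov (leviCivita (g.inChart x₀)) ((0 : FormField n (k + 1) M).inChart x₀) e u = 0 :=
    fun u => cov_zero u
  simp only [h0, FormField.zero_inChart, smul_zero, map_zero]

/-- The antisymmetrized derivative is a form of degree `k + 2 > n`. -/
theorem IsCKY.isClosedCKY_of_le {Y : FormField n (k + 1) M} (hY : g.IsCKY Y) (hn : n ≤ k + 1) :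
    g.IsClosedCKY Y := by
  refine ⟨hY, fun x₀ e _ v => ?_⟩
  rw [antisymmetrize_nabla, SkewForm.eq_zero_of_finrank_lt
    (by rw [finrank_euclideanSpace_fin]; omega) (alternatizeUncurryFin _)]
  simp

variable {g} {Y : FormField n (k + 1) M} {h : FormField n k M}

theorem IsCKYWith.inChart_eq_divergence [IsManifold (𝓡 n) ∞ M] {lam : ℝ}
    (hg : g.HasConstantCurvature lam) (hY : g.IsCKYWith Y h) (hn : k + 1 < n) (x₀ : M)
    {e : Coord n} (he : e ∈ (extChartAt (𝓡 n) x₀).target) (v : Fin k → Coord n) :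
    h.inChart x₀ e v =
      ((k + 1 : ℝ) / (2 * ((n : ℝ) + 1 - (k + 1)))) * g.divergence Y x₀ e v := by
  have h1 := (g.constCurvOn x₀ hg).sum_interior_cov (((g.isCKYWith_iff Y h).1 hY).2.2 x₀) he
    (g.isDualFrame x₀ he)
  have h2 := congrArg (fun φ => φ v) h1
  simp only [ContinuousAlternatingMap.sum_apply, interior_apply, ← nabla_eq_cov,
    ContinuousAlternatingMap.smul_apply, smul_eq_mul] at h2
  have hn' : (k + 1 : ℝ) < n := by exact_mod_cast hn
  have hk : (k + 1 : ℝ) ≠ 0 := by positivity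
  have hnk : (n : ℝ) - k ≠ 0 := by linarith
  rw [divergence, h2, show (n : ℝ) + 1 - (k + 1) = n - k by ring]
  field_simp

/-- The closed conformal Killing-Yano part of a conformal Killing-Yano tensor. -/
def closedPart (lam : ℝ) (h : FormField n k M) : FormField n (k + 1) M :=
  (-(2 / (lam * (k + 1) ^ 2))) • h.extDerivField

theorem closedPart_inChart [IsManifold (𝓡 n) ∞ M] (lam : ℝ) (hh : h.IsSmooth) (x₀ : M)
    {e : Coord n} (he : e ∈ (extChartAt (𝓡 n) x₀).target) :
    (closedPart lam h).inChart x₀ e =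
      (-(lam * (k + 1))⁻¹) • extDeriv (fun e => (2 / (k + 1) : ℝ) • h.inChart x₀ e) e := by
  rw [closedPart, FormField.smul_inChart, FormField.extDerivField_inChart hh x₀ he,
    show extDeriv (fun e => (2 / (k + 1) : ℝ) • h.inChart x₀ e) e =
      (2 / (k + 1) : ℝ) • extDeriv (h.inChart x₀) e from extDeriv_fun_smul _ _, smul_smul]
  congr 1
  have hk : (k + 1 : ℝ) ≠ 0 := by positivity
  rcases eq_or_ne lam 0 with rfl | hl
  · simp
  · field_simp

section ConstantCurvature

variable [IsManifold (𝓡 n) ∞ M] {lam : ℝ}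

theorem closedPart_isSmooth (lam : ℝ) (hh : h.IsSmooth) : (closedPart lam h).IsSmooth :=
  fun x₀ => ((hh.extDerivField x₀).const_smul (-(2 / (lam * (k + 1) ^ 2)) : ℝ)).congr
    fun e _ => FormField.smul_inChart _ _ x₀ e

theorem IsCKYWith.cov_closedPart (hg : g.HasConstantCurvature lam) (hlam : lam ≠ 0)
    (hY : g.IsCKYWith Y h) (hn : k + 1 < n) (hnk : ¬ (n = 2 ∧ k = 0)) (x₀ : M) {e : Coord n}
    (he : e ∈ (extChartAt (𝓡 n) x₀).target) (u : Coord n) :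
    cov (leviCivita (g.inChart x₀)) ((closedPart lam h).inChart x₀) e u =
      wedge (g.inChart x₀ e u) ((2 / (k + 1) : ℝ) • h.inChart x₀ e) := by
  have hU := g.constCurvOn x₀ hg
  have hη : ContDiffOn ℝ ∞ (fun e => (2 / (k + 1) : ℝ) • h.inChart x₀ e)
      (extChartAt (𝓡 n) x₀).target := (hY.2.1 x₀).const_smul _
  rw [cov_congr (hU.eventually_of he fun x hx => closedPart_inChart lam hY.2.1 x₀ hx),
    cov_smul _ (hU.differentiableAt (hU.smooth_extDeriv hη) he),
    hU.cov_extDeriv_divergence hn hnk (hY.1 x₀) hη (((g.isCKYWith_iff Y h).1 hY).2.2 x₀) he,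
    smul_smul]
  have hk : (k + 1 : ℝ) ≠ 0 := by positivity
  rw [neg_mul_neg, inv_mul_cancel₀ (mul_ne_zero hlam hk), one_smul]

theorem IsCKYWith.isClosedCKY_closedPart (hg : g.HasConstantCurvature lam) (hlam : lam ≠ 0)
    (hY : g.IsCKYWith Y h) (hn : k + 1 < n) (hnk : ¬ (n = 2 ∧ k = 0)) :
    g.IsClosedCKY (closedPart lam h) := by
  refine ⟨⟨h, (g.isCKYWith_iff _ _).2 ⟨closedPart_isSmooth lam hY.2.1, hY.2.1,
    fun x₀ e he u v => ?_⟩⟩, fun x₀ e he v => ?_⟩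
  · rw [hY.cov_closedPart hg hlam hn hnk x₀ he, hY.cov_closedPart hg hlam hn hnk x₀ he]
  · have h1 : cov (leviCivita (g.inChart x₀)) ((closedPart lam h).inChart x₀) e =
        wedge.flip ((2 / (k + 1) : ℝ) • h.inChart x₀ e) ∘L g.inChart x₀ e := by
      ext u : 1
      exact hY.cov_closedPart hg hlam hn hnk x₀ he u
    rw [antisymmetrize_nabla, h1, alternatize_wedge_of_symm _ (g.inChart_symm x₀ e)]
    simp

/-- The derivative of the closed part is exactly the wedge part of `∇Y`, so only the contraction
`ι_u` of a form survives. -/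
theorem IsCKYWith.isKY_sub_closedPart (hg : g.HasConstantCurvature lam) (hlam : lam ≠ 0)
    (hY : g.IsCKYWith Y h) (hn : k + 1 < n) (hnk : ¬ (n = 2 ∧ k = 0)) :
    g.IsKY (Y - closedPart lam h) := by
  have hH := closedPart_isSmooth lam hY.2.1
  refine (g.isCKYWith_iff _ _).2 ⟨fun x₀ => (hY.1 x₀).sub (hH x₀), FormField.isSmooth_zero,
    fun x₀ e he u v => ?_⟩
  have hU := g.constCurvOn x₀ hg
  have h1 : ∀ u, cov (leviCivita (g.inChart x₀)) ((Y - closedPart lam h).inChart x₀) e u =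
      interior u ((k + 2 : ℝ)⁻¹ • extDeriv (Y.inChart x₀) e) := by
    intro u
    have h2 := cov_sub (Γ := leviCivita (g.inChart x₀)) (hU.differentiableAt (hY.1 x₀) he)
      (hU.differentiableAt (hH x₀) he) u
    refine h2.trans ?_
    rw [hY.cov_closedPart hg hlam hn hnk x₀ he,
      hU.cov_eq_of_cky (((g.isCKYWith_iff Y h).1 hY).2.2 x₀) he, add_sub_cancel_right]
  simp only [h1, FormField.zero_inChart, smul_zero, map_zero, add_zero]
  rw [interior_comm, neg_add_cancel]

/-- Since `∇h` is already totally skew, `dh` is just `k + 1` times it, which removes one factor `k +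
1` from the coefficient of `closedPart`. -/
theorem IsCKYWith.closedPart_eq_nabla (hg : g.HasConstantCurvature lam)
    (hY : g.IsCKYWith Y h) (hn : k + 1 < n) (x₀ : M) {e : Coord n}
    (he : e ∈ (extChartAt (𝓡 n) x₀).target) (v : Fin (k + 1) → Coord n) :
    (closedPart lam h).inChart x₀ e v =
      -(2 / (lam * (k + 1))) * g.nabla h x₀ e (v 0) (Fin.tail v) := by
  have hU := g.constCurvOn x₀ hg
  have hη : ContDiffOn ℝ ∞ (fun e => (2 / (k + 1) : ℝ) • h.inChart x₀ e)
      (extChartAt (𝓡 n) x₀).target := (hY.2.1 x₀).const_smul _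
  have h1 := hU.cov_divergence_eq hn (hY.1 x₀) hη (((g.isCKYWith_iff Y h).1 hY).2.2 x₀) he (v 0)
  rw [cov_smul _ (hU.differentiableAt (hY.2.1 x₀) he)] at h1
  have h2 := congrArg (fun φ => φ (Fin.tail v)) h1
  simp only [ContinuousAlternatingMap.smul_apply, interior_apply, smul_eq_mul,
    Fin.cons_self_tail, ← nabla_eq_cov] at h2
  rw [closedPart_inChart lam hY.2.1 x₀ he, ContinuousAlternatingMap.smul_apply, smul_eq_mul,
    mul_inv, ← neg_mul, mul_assoc, ← h2]
  simp only [div_eq_mul_inv, mul_inv]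
  ring

end ConstantCurvature

end PseudoRiemannianMetric

end

theorem mainTheorem2 {n : ℕ} {M : Type*} [TopologicalSpace M] [ChartedSpace (Coord n) M]
    [IsManifold (𝓡 n) ∞ M] (g : PseudoRiemannianMetric n M) (lam : ℝ) (hlam : lam ≠ 0)
    (hg : g.HasConstantCurvature lam) (k : ℕ) (hnk : ¬ (n = 2 ∧ k + 1 = 1))
    (Y : FormField n (k + 1) M) (hY : g.IsCKY Y) :
    (∃ A H : FormField n (k + 1) M, g.IsKY A ∧ g.IsClosedCKY H ∧ Y = A + H) ∧
    (k + 1 < n → ∀ h : FormField n k M, g.IsCKYWith Y h →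
      (∀ x₀ : M, ∀ e ∈ (extChartAt (𝓡 n) x₀).target, ∀ v : Fin k → Coord n,
        h.inChart x₀ e v =
          ((k + 1 : ℝ) / (2 * ((n : ℝ) + 1 - (k + 1)))) * g.divergence Y x₀ e v) ∧
      ∃ A H : FormField n (k + 1) M, g.IsKY A ∧ g.IsClosedCKY H ∧ Y = A + H ∧
        ∀ x₀ : M, ∀ e ∈ (extChartAt (𝓡 n) x₀).target, ∀ v : Fin (k + 1) → Coord n,
          H.inChart x₀ e v = -(2 / (lam * (k + 1))) * g.nabla h x₀ e (v 0) (Fin.tail v)) := by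
  have hnk' : ¬ (n = 2 ∧ k = 0) := fun h => hnk ⟨h.1, by rw [h.2]⟩
  have key : k + 1 < n → ∀ h : FormField n k M, g.IsCKYWith Y h →
      g.IsKY (Y - PseudoRiemannianMetric.closedPart lam h) ∧
      g.IsClosedCKY (PseudoRiemannianMetric.closedPart lam h) ∧
      Y = (Y - PseudoRiemannianMetric.closedPart lam h) +
        PseudoRiemannianMetric.closedPart lam h := fun hn h hYh =>
    ⟨hYh.isKY_sub_closedPart hg hlam hn hnk', hYh.isClosedCKY_closedPart hg hlam hn hnk',
      (sub_add_cancel _ _).symm⟩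
  refine ⟨?_, fun hn h hYh => ⟨fun x₀ e he v => hYh.inChart_eq_divergence hg hn x₀ he v, ?_⟩⟩
  · rcases lt_or_ge (k + 1) n with hn | hn
    · obtain ⟨h, hYh⟩ := hY
      exact ⟨_, _, key hn h hYh⟩
    · exact ⟨0, Y, g.isKY_zero, hY.isClosedCKY_of_le g hn, (zero_add Y).symm⟩
  · obtain ⟨h1, h2, h3⟩ := key hn h hYh
    exact ⟨_, _, h1, h2, h3, fun x₀ e he v => hYh.closedPart_eq_nabla hg hn x₀ he v⟩
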